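/- **Conventions.** $G$ is an undirected multigraph with $n\ge 3$ vertices and $m$ edges, and $p\in(0,1)$. $u_G(p)$ is the probability that $G$ is disconnected after every edge has been deleted independently with probability $p$. A cut is the set of edges with exactly one endpoint in $S$, for some nonempty proper vertex set $S$; $d_G(S)$ is the number of these edges and $\lambda_G$ is the minimum value of a cut. Let $z_G(p)=\sum_{C}p^{|C|}$ over all cuts and $x_G(p)=\sum_{\{C,C'\}}p^{|C\cup C'|}$ over all unordered pairs of distinct cuts. Logarithms are natural. For a constant $c>0$, the phase transition threshold $\theta=\theta_c(G)$ is the supremum of the $t\in[0,1]$ such that $u_G(t)\le n^{-c/\log\log n}$ and $x_G(p')/z_G(p')\le 1/\log n$ for all $0<p'<t$ (and $\theta=0$ if there is no such $t$). For constants $C$ and $c>0$, the pair $(G,p)$ is in the recursive case if $u_G(p)\ge n^{-1-C/\log\log n}$ and $p<\theta_c(G)$. The relative second moment of $X$ is $\mathbb E[X^2]/(\mathbb E[X])^2$. The model of computation is a randomized RAM with words of $O(\log(n+m))$ bits and with real registers. Every step is one operation of unit cost: an arithmetic operation or a comparison on words or on reals, a memory access, the conversion of a word to a real, or the toss of an independent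 coin whose bias is in a real register. **Lemma.** For all real constants $C$, $c>0$ and $b$ there are a program, a word-size constant, and constants $K$ and $k$, such that for every $G$ and $p$ as above in the recursive case the following holds. On input $(G,p)$ the program always halts, within $K\,m\,(\log n)^k=\tilde O(m)$ steps, and outputs a random spanning subgraph $H$ of $G$ and a number $q$ that is not random, with $0<q<p$, such that 1. ($H$ is a sparsifier with small minimum cut) there is $\alpha\in(0,1]$ such that, with probability at least $1-n^{-b}$, $\lambda_H\le K(\log n)^k=\tilde O(1)$ and $\left(1-\tfrac{K}{\log n}\right)\alpha\, d_G(S)\le d_H(S)\le\left(1+\tfrac{K}{\log n}\right)\alpha\, d_G(S)$ for every vertex set $S$; 2. $u_H(q)$ is an unbiased estimator of $u_G(p)$, that is, $\mathbb E[u_H(q)]=u_G(p)$; 3. the relative second moment of $u_H(q)$ is at most $2+\tfrac{K}{\log n}$. -/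

import Mathlib

open scoped ENNReal NNReal

namespace Unreliability

noncomputable section

/-! ### Multigraphs, cuts and unreliability -/

/-- A finite undirected multigraph on the vertex set `Fin n`, given by the list of its `m` edges.
The two endpoints of an edge are listed in some order, which carries no meaning. -/
structure Multigraph (n : ℕ) where
  m : ℕ
  ends : Fin m → Fin n × Fin n

namespace Multigraph

variable {n : ℕ}

/-- The simple graph on the vertices in which two distinct vertices are adjacent when they are
joined by an edge of `A`. -/
def adjVia (G : Multigraph n) (A : Finset (Fin G.m)) : SimpleGraph (Fin n) :=
  SimpleGraph.fromRel (fun u v => ∃ e ∈ A, G.ends e = (u, v))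

open Classical in
/-- The unreliability `u_G(p)`: the probability that `G` is disconnected after every edge has
failed (has been deleted) independently with probability `p`. The sum is over the set `F` of
the failing edges. -/
def unreliability (G : Multigraph n) (p : ℝ) : ℝ :=
  ∑ F : Finset (Fin G.m),
    if (G.adjVia Fᶜ).Connected then 0 else p ^ F.card * (1 - p) ^ Fᶜ.card

/-- The edges with exactly one endpoint in `S`. -/
def boundary (G : Multigraph n) (S : Finset (Fin n)) : Finset (Fin G.m) :=
  Finset.univ.filter (fun e => ¬ ((G.ends e).1 ∈ S ↔ (G.ends e).2 ∈ S))

/-- The cuts of `G`, as sets of edges: the boundaries of the nonempty proper vertex sets. Thus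
the two sides of a bipartition give one cut. -/
def cuts (G : Multigraph n) : Finset (Finset (Fin G.m)) :=
  (Finset.univ.filter (fun S : Finset (Fin n) => S.Nonempty ∧ S ≠ Finset.univ)).image G.boundary

/-- The value `λ_G` of a minimum cut. -/
def minCut (G : Multigraph n) : ℕ :=
  sInf (Finset.card '' (G.cuts : Set (Finset (Fin G.m))))

/-- `z_G(p)`: the expected number of failed cuts. -/
def expFailedCuts (G : Multigraph n) (p : ℝ) : ℝ :=
  ∑ C ∈ G.cuts, p ^ C.card

/-- `x_G(p)`: the expected number of failed pairs of distinct cuts (unordered pairs, hence the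
division of the sum over ordered pairs by two). -/
def expFailedPairs (G : Multigraph n) (p : ℝ) : ℝ :=
  (∑ P ∈ G.cuts.offDiag, p ^ (P.1 ∪ P.2).card) / 2

/-- The phase transition threshold `θ`: the largest `t` with `u_G(t) ≤ n^{-c / log log n}` such
that `x_G(p) / z_G(p) ≤ 1 / log n` for all `p < t`. -/
def threshold (G : Multigraph n) (c : ℝ) : ℝ :=
  sSup {t : ℝ | 0 ≤ t ∧ t ≤ 1 ∧
    G.unreliability t ≤ (n : ℝ) ^ (-c / Real.log (Real.log n)) ∧
    ∀ p : ℝ, 0 < p → p < t → G.expFailedPairs p ≤ G.expFailedCuts p / Real.log n}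

/-- The recursive case: `u_G(p) ≥ n^{-1 - C / log log n}` and `p < θ`. -/
def RecursiveCase (G : Multigraph n) (C c p : ℝ) : Prop :=
  (n : ℝ) ^ (-1 - C / Real.log (Real.log n)) ≤ G.unreliability p ∧ p < G.threshold c

/-- `H` is a spanning subgraph of `G`: it has the same vertices, and its edges are some of the
edges of `G`, in any order. -/
def IsSubgraph (H G : Multigraph n) : Prop :=
  ∃ f : Fin H.m → Fin G.m, Function.Injective f ∧ ∀ e, H.ends e = G.ends (f e)

/-- After scaling by `1 / α`, every cut of `H` has its value in `G` up to a factor `1 ± δ`. -/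
def PreservesCuts (H G : Multigraph n) (α δ : ℝ) : Prop :=
  ∀ S : Finset (Fin n), (1 - δ) * α * (G.boundary S).card ≤ (H.boundary S).card ∧
    ((H.boundary S).card : ℝ) ≤ (1 + δ) * α * (G.boundary S).card

end Multigraph

/-! ### Moments of a discrete random variable -/

/-- The expectation of `X` under `μ`. -/
def expect {Ω : Type*} (μ : PMF Ω) (X : Ω → ℝ) : ℝ := ∑' ω, (μ ω).toReal * X ω

/-- The relative second moment `E[X²] / (E[X])²`. -/
def relSecondMoment {Ω : Type*} (μ : PMF Ω) (X : Ω → ℝ) : ℝ :=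
  expect μ (fun ω => X ω ^ 2) / expect μ X ^ 2

/-- The probability of an event. -/
def prob {Ω : Type*} (μ : PMF Ω) (E : Set Ω) : ℝ := (μ.toOuterMeasure E).toReal

/-! ### Randomized random access machines

A machine has word registers, real registers and a memory of words. Words are natural numbers
below a bound `W`, and arithmetic on words is modulo `W`. Every instruction takes one step. -/

inductive Instr where
  /-- `reg d := k` -/
  | const (d k : ℕ)
  | add (d a b : ℕ)
  | sub (d a b : ℕ)
  | mul (d a b : ℕ)
  | div (d a b : ℕ)
  /-- `reg d := mem (reg a)` -/
  | load (d a : ℕ)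
  /-- `mem (reg a) := reg b` -/
  | store (a b : ℕ)
  /-- if `reg a < reg b`, go to instruction `t` -/
  | jlt (a b t : ℕ)
  /-- `rreg d := reg a` -/
  | rcast (d a : ℕ)
  | radd (d a b : ℕ)
  | rsub (d a b : ℕ)
  | rmul (d a b : ℕ)
  | rdiv (d a b : ℕ)
  /-- if `rreg a < rreg b`, go to instruction `t` -/
  | rjlt (a b t : ℕ)
  /-- `reg d` becomes `1` with probability `rreg a` (clamped to `[0, 1]`), and `0` otherwise,
  independently of everything before -/
  | coin (d a : ℕ)

structure State where
  pc : ℕ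
  reg : ℕ → ℕ
  rreg : ℕ → ℝ
  mem : ℕ → ℕ

/-- A coin with probability `r` of `true`, where `r` is clamped to `[0, 1]`. -/
def flip (r : ℝ) : PMF Bool :=
  PMF.ofFintype (fun b => cond b ((min r.toNNReal 1 : ℝ≥0) : ℝ≥0∞)
    (1 - ((min r.toNNReal 1 : ℝ≥0) : ℝ≥0∞))) (by simp)

/-- Set a word register (modulo `W`) and go to the next instruction. -/
def State.setReg (s : State) (W d v : ℕ) : State :=
  { s with pc := s.pc + 1, reg := Function.update s.reg d (v % W) }

/-- Set a real register and go to the next instruction. -/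
def State.setRReg (s : State) (d : ℕ) (v : ℝ) : State :=
  { s with pc := s.pc + 1, rreg := Function.update s.rreg d v }

open Classical in
/-- The effect of one instruction. -/
def Instr.exec (W : ℕ) (s : State) : Instr → PMF State
  | .const d k => PMF.pure (s.setReg W d k)
  | .add d a b => PMF.pure (s.setReg W d (s.reg a + s.reg b))
  | .sub d a b => PMF.pure (s.setReg W d (s.reg a - s.reg b))
  | .mul d a b => PMF.pure (s.setReg W d (s.reg a * s.reg b))
  | .div d a b => PMF.pure (s.setReg W d (s.reg a / s.reg b))
  | .load d a => PMF.pure (s.setReg W d (s.mem (s.reg a)))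
  | .store a b => PMF.pure
      { s with pc := s.pc + 1, mem := Function.update s.mem (s.reg a) (s.reg b) }
  | .jlt a b t => PMF.pure { s with pc := if s.reg a < s.reg b then t else s.pc + 1 }
  | .rcast d a => PMF.pure (s.setRReg d (s.reg a))
  | .radd d a b => PMF.pure (s.setRReg d (s.rreg a + s.rreg b))
  | .rsub d a b => PMF.pure (s.setRReg d (s.rreg a - s.rreg b))
  | .rmul d a b => PMF.pure (s.setRReg d (s.rreg a * s.rreg b))
  | .rdiv d a b => PMF.pure (s.setRReg d (s.rreg a / s.rreg b))
  | .rjlt a b t => PMF.pure { s with pc := if s.rreg a < s.rreg b then t else s.pc + 1 }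
  | .coin d a => (flip (s.rreg a)).map (fun b => s.setReg W d (if b then 1 else 0))

/-- A program is a finite list of instructions; a machine whose program counter has left the
program has halted. -/
abbrev Program := List Instr

/-- One step of the machine; nothing happens after halting. -/
def step (P : Program) (W : ℕ) (s : State) : PMF State :=
  match P[s.pc]? with
  | some i => i.exec W s
  | none => PMF.pure s

/-- The distribution of the state after `T` steps. -/
def run (P : Program) (W : ℕ) : ℕ → State → PMF State
  | 0, s => PMF.pure s
  | T + 1, s => (step P W s).bind (run P W T)

/-- The input: `n` and the number of edges in word registers `0` and `1`, the endpoints of edge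
`i` in the memory cells `2 i` and `2 i + 1`, the failure probability in real register `0`, and
zeros elsewhere. -/
def initState {n : ℕ} (G : Multigraph n) (p : ℝ) : State where
  pc := 0
  reg := fun i => if i = 0 then n else if i = 1 then G.m else 0
  rreg := fun i => if i = 0 then p else 0
  mem := fun j =>
    if h : j / 2 < G.m then
      (if j % 2 = 0 then ((G.ends ⟨j / 2, h⟩).1 : ℕ) else ((G.ends ⟨j / 2, h⟩).2 : ℕ))
    else 0

/-- The state is halted, and its registers and memory hold the multigraph `H` on `n` vertices and
the probability `q`, in the same layout as in the input. -/
def Outputs {n : ℕ} (P : Program) (s : State) (H : Multigraph n) (q : ℝ) : Prop :=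
  P.length ≤ s.pc ∧ s.reg 0 = n ∧ s.reg 1 = H.m ∧ s.rreg 0 = q ∧
    ∀ e : Fin H.m, s.mem (2 * e) = (H.ends e).1 ∧ s.mem (2 * e + 1) = (H.ends e).2

/-- On input `(G, p)` and with words of at most `κ log₂ (n + m + 2)` bits, the program `P` always
halts within `T` steps with a multigraph and the number `q` as its output, and the random
multigraph has the law `μ`. -/
def Computes {n : ℕ} (P : Program) (κ T : ℕ) (G : Multigraph n) (p : ℝ)
    (μ : PMF (Multigraph n)) (q : ℝ) : Prop :=
  ∃ out : State → Multigraph n,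
    (∀ s ∈ (run P ((n + G.m + 2) ^ κ) T (initState G p)).support, Outputs P s (out s) q) ∧
    (run P ((n + G.m + 2) ^ κ) T (initState G p)).map out = μ

end

end Unreliability

/-!
Every edge of `G` is kept with probability `α = (1 - p) / (1 - q)`, independently of the others. A
kept edge fails with probability `q`, so that an edge of `G` survives both stages with probability
`α (1 - q) = 1 - p`; this makes `u_H(q)` an unbiased estimator of `u_G(p)` for every `q < p`. It
remains to choose `q`, up to constants, so that `1 - q = 1 / (A L ^ 3)` with `L = ⌈log₂ n⌉`.

*Second moment.* `E[u_H(q) ^ 2]` is the squared `L²`-norm of a conditional mean of the indicator of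
disconnection, which is a monotone function of the failing edges. For monotone functions the
conditional mean is hypercontractive: its `L²`-norm is at most the `L^s`-norm of the function, with
`s = 2 - q` (`keepAvg_failAvg_sq_le`). This tensorizes, so that it reduces to an inequality for a
single edge (`two_point`), which is where monotonicity is needed. For an indicator it says that
`E[u_H(q) ^ 2] ≤ u_G(p) ^ (2 / s)`. As `2 / s` differs from `2` by at most `2 (1 - q)`, and `u_G(p)`
is at least a fixed power of `1 / n`, the relative second moment is bounded by
`n ^ O(1 / (A L ^ 3)) ≤ 2`.

*Cuts.* Contraction of random edges bounds the number of cuts of each size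
(`card_cutSize_le`), hence the sum of `exp (-τ d_G(S))` over the cuts once `τ λ_G` is a large
multiple of `log n` (`sum_exp_cutSize_le`). This is used twice. With `exp (-τ) = p` it bounds
`u_G(p)`, and the lower bound on `u_G(p)` gives `λ_G (1 - p) = O(log n)`. With the exponent from
Chernoff's bound it shows that sampling preserves all cuts when `α λ_G` is a large multiple of
`(log n) ^ 3` (`Multigraph.keepAvg_not_preservesCuts_le`); that follows from a lower bound on
`λ_G (1 - p)`, which holds because `p ^ λ_G` is at most the unreliability at a point between `p` and
the threshold.

The choice of `q` above needs `q < p`. If that fails, then `1 - p` is at least `1 / (A L ^ 3)`, so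
that `λ_G` is polylogarithmic already. Then `q` is taken so close to `p` that with high probability
no edge is deleted, and everything is immediate (`goodSample_of_le`).

The program `sparsify` computes `L`, `q` and `α`, and then goes through the edges once, tossing one
coin for each. The random multigraph is handled as a random sublist of the list of edges, so that
its law (`keepLaw`), means over it (`keepAvg`) and the unreliability (`failAvg`) are all given by
recursion on that list.
-/

namespace Unreliability

noncomputable section

/-! ### Counting cuts -/

section CutCounting

variable {E V : Type*} [Fintype E] [Fintype V] [DecidableEq V]

/-- The number of the edges `e`, with endpoints `a e` and `b e`, that have exactly one endpoint
in `S`. -/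
def cutSize (a b : E → V) (S : Finset V) : ℕ :=
  (Finset.univ.filter fun e => ¬ (a e ∈ S ↔ b e ∈ S)).card

theorem sum_cutSize_singleton (a b : E → V) :
    ∑ v, cutSize a b {v} = 2 * (Finset.univ.filter fun e => a e ≠ b e).card := by
  simp only [cutSize, Finset.card_filter, Finset.mem_singleton]
  rw [Finset.sum_comm, Finset.mul_sum]
  refine Finset.sum_congr rfl fun e _ => ?_
  rw [← Finset.card_filter]
  by_cases h : a e = b e
  · simp [h]
  · rw [if_pos h, mul_one]
    have : (Finset.univ.filter fun v => ¬ (a e = v ↔ b e = v)) = {a e, b e} := by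
      ext v
      simp only [Finset.mem_filter, Finset.mem_univ, true_and, Finset.mem_insert,
        Finset.mem_singleton]
      grind
    rw [this, Finset.card_pair h]

/-- The vertex `v` is merged into the vertex `u`. -/
def mergeVertex (u v : V) (h : u ≠ v) (x : V) : {x // x ≠ v} :=
  if hx : x = v then ⟨u, h⟩ else ⟨x, hx⟩

/-- Karger's cut counting bound, in a form that needs no rounding of `2 k / c`. The proof averages
over the contraction of a random edge that is not a loop; it is an induction that starts at `r`
vertices. -/
theorem card_cutSize_le_aux (r c k : ℕ) (hr : 1 ≤ r) (hc : 1 ≤ c) (hk : 2 * k ≤ r * c) (N : ℕ)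
    (hN : r ≤ N) : ∀ {V : Type} [Fintype V] [DecidableEq V] (a b : E → V),
    Fintype.card V = N →
    (∀ S : Finset V, S.Nonempty → S ≠ Finset.univ → c ≤ cutSize a b S) →
    (Finset.univ.filter fun S : Finset V => cutSize a b S ≤ k).card ≤ 2 ^ r * N.choose r := by
  induction N, hN using Nat.le_induction with
  | base =>
    intro V _ _ a b hV _
    rw [Nat.choose_self, mul_one]
    exact (Finset.card_filter_le _ _).trans (by simp [hV])
  | succ N hN ih =>
    intro V _ _ a b hV hcut
    set 𝒮 := Finset.univ.filter fun S : Finset V => cutSize a b S ≤ k with h𝒮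
    set M := Finset.univ.filter fun e => a e ≠ b e with hM
    have hMc : (N + 1) * c ≤ 2 * M.card := by
      rw [← sum_cutSize_singleton, ← hV, ← smul_eq_mul, ← Finset.card_univ]
      refine Finset.card_nsmul_le_sum _ _ _ fun v _ => hcut _ (Finset.singleton_nonempty v) ?_
      intro h
      have := congrArg Finset.card h
      rw [Finset.card_singleton, Finset.card_univ, hV] at this
      omega
    -- vertex sets not separating the ends of `e` are vertex sets of the contraction of `e`
    have hcontract : ∀ e ∈ M, (𝒮.filter fun S => (a e ∈ S ↔ b e ∈ S)).card ≤
        2 ^ r * N.choose r := by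
      intro e he
      have hne : a e ≠ b e := (Finset.mem_filter.1 he).2
      set π := mergeVertex (a e) (b e) hne with hπ
      have hlift : ∀ S' : Finset {x // x ≠ b e},
          cutSize (π ∘ a) (π ∘ b) S' = cutSize a b (Finset.univ.filter fun x => π x ∈ S') := by
        intro S'
        simp [cutSize]
      have hdown : ∀ S : Finset V, (a e ∈ S ↔ b e ∈ S) →
          (Finset.univ.filter fun x => π x ∈ S.subtype (· ≠ b e)) = S := by
        intro S hS
        ext x
        simp only [Finset.mem_filter, Finset.mem_univ, true_and, hπ, mergeVertex,
          Finset.mem_subtype]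
        split_ifs with hx
        · subst hx; exact hS
        · rfl
      refine le_trans ?_ (ih (V := {x // x ≠ b e}) (π ∘ a) (π ∘ b) ?_ ?_)
      · refine Finset.card_le_card_of_injOn (fun S => S.subtype (· ≠ b e)) ?_ ?_
        · intro S hS
          simp only [Finset.coe_filter, Set.mem_ofPred_eq, h𝒮, Finset.mem_filter,
            Finset.mem_univ, true_and] at hS ⊢
          rw [hlift, hdown S hS.2]
          exact hS.1
        · intro S hS T hT hST
          simp only [Finset.coe_filter, Set.mem_ofPred_eq] at hS hT hST
          rw [← hdown S hS.2, ← hdown T hT.2, hST]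
      · rw [Fintype.card_subtype_compl, hV]; simp
      · intro S' ⟨s, hs⟩ hne'
        rw [hlift]
        refine hcut _ ⟨s, ?_⟩ ?_
        · have : π s = s := by simp [hπ, mergeVertex, s.2]
          simpa [this] using hs
        · intro h
          refine hne' (Finset.eq_univ_of_forall fun x => ?_)
          have hx : (x : V) ∈ Finset.univ.filter fun x => π x ∈ S' := by
            rw [h]; exact Finset.mem_univ _
          have : π x = x := by simp [hπ, mergeVertex, x.2]
          simpa [this] using hx
    -- double counting of the pairs of a small cut and an edge not in it
    have hdouble : 𝒮.card * M.card ≤ 𝒮.card * k + M.card * (2 ^ r * N.choose r) := by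
      have h1 : ∑ S ∈ 𝒮, M.card ≤ ∑ S ∈ 𝒮, (k + (M.filter fun e => (a e ∈ S ↔ b e ∈ S)).card) := by
        refine Finset.sum_le_sum fun S hS => ?_
        rw [← Finset.card_filter_add_card_filter_not (s := M) (fun e => (a e ∈ S ↔ b e ∈ S)),
          add_comm]
        refine Nat.add_le_add_right (le_trans (Finset.card_le_card ?_)
          (Finset.mem_filter.1 hS).2) _
        exact Finset.filter_subset_filter _ (Finset.subset_univ _)
      have h2 : ∑ S ∈ 𝒮, (M.filter fun e => (a e ∈ S ↔ b e ∈ S)).card =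
          ∑ e ∈ M, (𝒮.filter fun S => (a e ∈ S ↔ b e ∈ S)).card := by
        simp only [Finset.card_filter]
        exact Finset.sum_comm
      rw [Finset.sum_add_distrib, h2] at h1
      simp only [Finset.sum_const, smul_eq_mul] at h1
      refine h1.trans (Nat.add_le_add_left ?_ _)
      rw [← smul_eq_mul]
      exact Finset.sum_le_card_nsmul _ _ _ hcontract
    have hM0 : 0 < M.card := by
      have : 1 * 1 ≤ (N + 1) * c := Nat.mul_le_mul (by omega) hc
      omega
    have hch : N.choose r * (N + 1) = (N + 1).choose r * (N + 1 - r) :=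
      Nat.choose_mul_succ_eq N r
    obtain ⟨d, hd⟩ : ∃ d, N + 1 = r + d := ⟨N + 1 - r, by omega⟩
    have hd' : N + 1 - r = d := by omega
    rw [hd'] at hch
    have hd0 : 0 < d := by omega
    -- `k ≤ r |M| / (N + 1)`, as the average degree is at least `c`
    have hkM : k * (N + 1) ≤ r * M.card := by
      have h1 : 2 * k * (N + 1) ≤ r * c * (N + 1) := Nat.mul_le_mul_right _ hk
      have h2 : r * ((N + 1) * c) ≤ r * (2 * M.card) := Nat.mul_le_mul_left _ hMc
      nlinarith
    have h3 : 𝒮.card * d * M.card ≤ 2 ^ r * (N + 1).choose r * d * M.card := by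
      have h4 := Nat.mul_le_mul_right (N + 1) hdouble
      have h5 := Nat.mul_le_mul_left 𝒮.card hkM
      have h6 : 2 ^ r * (N + 1).choose r * d * M.card =
          M.card * (2 ^ r * N.choose r) * (N + 1) := by
        rw [show M.card * (2 ^ r * N.choose r) * (N + 1) =
          M.card * (2 ^ r * (N.choose r * (N + 1))) by ring, hch]; ring
      rw [h6]
      have h7 : 𝒮.card * M.card * (N + 1) = 𝒮.card * d * M.card + 𝒮.card * (r * M.card) := by
        rw [hd]; ring
      have h8 : (𝒮.card * k + M.card * (2 ^ r * N.choose r)) * (N + 1) =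
        𝒮.card * (k * (N + 1)) + M.card * (2 ^ r * N.choose r) * (N + 1) := by ring
      omega
    exact Nat.le_of_mul_le_mul_right (Nat.le_of_mul_le_mul_right h3 hM0) hd0

/-- The cut counting bound for all numbers of vertices: when there are at most `r` of them, there
are at most `2 ^ r` vertex sets. -/
theorem card_cutSize_le {V : Type} [Fintype V] [DecidableEq V] [Nonempty V] (a b : E → V)
    {r c k : ℕ} (hr : 1 ≤ r) (hc : 1 ≤ c) (hk : 2 * k ≤ r * c)
    (hcut : ∀ S : Finset V, S.Nonempty → S ≠ Finset.univ → c ≤ cutSize a b S) :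
    (Finset.univ.filter fun S : Finset V => cutSize a b S ≤ k).card ≤
      (2 * Fintype.card V) ^ r := by
  rw [mul_pow]
  rcases le_total r (Fintype.card V) with h | h
  · exact (card_cutSize_le_aux r c k hr hc hk _ h a b rfl hcut).trans
      (Nat.mul_le_mul_left _ (Nat.choose_le_pow _ _))
  · refine (Finset.card_filter_le _ _).trans ?_
    rw [Finset.card_univ, Fintype.card_finset]
    exact (Nat.pow_le_pow_right (by norm_num) h).trans
      (Nat.le_mul_of_pos_right _ (pow_pos Fintype.card_pos _))

/-- Once `exp (-τ)` to the power of the minimum cut is a large enough inverse power of the number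
of vertices, the cuts are so few that their expected number is small too. -/
theorem sum_exp_cutSize_le {V : Type} [Fintype V] [DecidableEq V] [Nonempty V] (a b : E → V)
    {c : ℕ} {τ B : ℝ} (hc : 1 ≤ c) (hB : 0 ≤ B) (hτ0 : 0 ≤ τ)
    (hτ : 2 * (B + 2) * Real.log (2 * Fintype.card V) ≤ c * τ)
    (hcut : ∀ S : Finset V, S.Nonempty → S ≠ Finset.univ → c ≤ cutSize a b S) :
    ∑ S ∈ Finset.univ.filter (fun S : Finset V => S.Nonempty ∧ S ≠ Finset.univ),
      Real.exp (-τ * cutSize a b S) ≤ 2 * (2 * Fintype.card V : ℝ) ^ (-B) := by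
  set X : ℝ := 2 * Fintype.card V with hX
  have hX2 : 2 ≤ X := by
    have : (1 : ℝ) ≤ Fintype.card V := by exact_mod_cast Fintype.card_pos (α := V)
    rw [hX]; linarith
  have hX0 : 0 < X := by linarith
  set 𝒯 := Finset.univ.filter (fun S : Finset V => S.Nonempty ∧ S ≠ Finset.univ) with h𝒯
  -- the level `j` holds the cuts whose size is between `j c / 2` and `(j + 1) c / 2`
  let lev : Finset V → ℕ := fun S => 2 * cutSize a b S / c
  let R := (𝒯.sup lev) + 1
  have hmaps : ∀ S ∈ 𝒯, lev S ∈ Finset.range R := fun S hS =>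
    Finset.mem_range.2 (Nat.lt_succ_of_le (Finset.le_sup hS))
  rw [← Finset.sum_fiberwise_of_maps_to hmaps]
  have hy0 : 0 ≤ X ^ (-(B + 1)) := Real.rpow_nonneg hX0.le _
  have hy1 : X ^ (-(B + 1)) ≤ 1 / 2 := by
    calc X ^ (-(B + 1)) ≤ X ^ (-1 : ℝ) :=
          Real.rpow_le_rpow_of_exponent_le (by linarith) (by linarith)
      _ = X⁻¹ := Real.rpow_neg_one X
      _ ≤ 1 / 2 := by rw [one_div]; exact inv_anti₀ (by norm_num) hX2
  have hlevel : ∀ j ∈ Finset.range R, ∑ S ∈ 𝒯 with lev S = j, Real.exp (-τ * cutSize a b S) ≤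
      if j = 0 then 0 else X * (X ^ (-(B + 1))) ^ j := by
    intro j _
    split_ifs with hj
    · refine le_of_eq (Finset.sum_eq_zero fun S hS => ?_)
      exfalso
      simp only [h𝒯, Finset.mem_filter, Finset.mem_univ, true_and] at hS
      have h1 := hcut S hS.1.1 hS.1.2
      have h2 : 1 ≤ lev S := (Nat.one_le_div_iff hc).2 (by omega)
      omega
    · have hcard : ((𝒯.filter fun S => lev S = j).card : ℝ) ≤ X ^ (j + 1) := by
        have h1 : (𝒯.filter fun S => lev S = j).card ≤ (2 * Fintype.card V) ^ (j + 1) := by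
          refine le_trans (Finset.card_le_card ?_) (card_cutSize_le a b (r := j + 1)
            (k := (j + 1) * c / 2) (by omega) hc (Nat.mul_div_le _ _) hcut)
          intro S hS
          simp only [Finset.mem_filter, Finset.mem_univ, true_and] at hS ⊢
          have := Nat.lt_mul_div_succ (2 * cutSize a b S) hc
          rw [show 2 * cutSize a b S / c = j from hS.2, mul_comm c] at this
          change 2 * cutSize a b S < (j + 1) * c at this
          omega
        calc ((𝒯.filter fun S => lev S = j).card : ℝ)
            ≤ ((2 * Fintype.card V) ^ (j + 1) : ℕ) := by exact_mod_cast h1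
          _ = X ^ (j + 1) := by rw [hX]; push_cast; ring
      have hterm : ∀ S ∈ 𝒯.filter (fun S => lev S = j), Real.exp (-τ * cutSize a b S) ≤
          (X ^ (-(B + 2))) ^ j := by
        intro S hS
        have h1 : j * c ≤ 2 * cutSize a b S := by
          rw [← (Finset.mem_filter.1 hS).2]; exact Nat.div_mul_le_self _ _
        have h2 : (j * c : ℝ) ≤ 2 * cutSize a b S := by exact_mod_cast h1
        rw [← Real.rpow_natCast, ← Real.rpow_mul hX0.le, Real.rpow_def_of_pos hX0]
        apply Real.exp_le_exp.2
        have h3 := mul_le_mul_of_nonneg_left hτ (Nat.cast_nonneg (α := ℝ) j)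
        have h4 := mul_le_mul_of_nonneg_right h2 hτ0
        nlinarith
      refine (Finset.sum_le_card_nsmul _ _ _ hterm).trans ?_
      rw [nsmul_eq_mul]
      refine (mul_le_mul_of_nonneg_right hcard (by positivity)).trans (le_of_eq ?_)
      rw [show -(B + 1) = 1 + -(B + 2) by ring, Real.rpow_add hX0, Real.rpow_one, mul_pow]
      ring
  refine (Finset.sum_le_sum hlevel).trans ?_
  have hgeom : ∑ j ∈ Finset.range R, (if j = 0 then 0 else X * (X ^ (-(B + 1))) ^ j) ≤
      X * (2 * X ^ (-(B + 1))) := by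
    rw [Finset.sum_range_succ']
    simp only [Nat.add_eq_zero_iff, one_ne_zero, and_false, if_false, if_true, add_zero,
      pow_succ, ← mul_assoc, ← Finset.sum_mul, ← Finset.mul_sum]
    have h1 : ∑ i ∈ Finset.range (𝒯.sup lev), (X ^ (-(B + 1))) ^ i ≤ 2 := by
      rw [Finset.range_eq_Ico]
      refine (geom_sum_Ico_le_of_lt_one hy0 (by linarith)).trans ?_
      rw [pow_zero, div_le_iff₀ (by linarith)]
      linarith
    have := mul_le_mul_of_nonneg_left h1 hX0.le
    nlinarith
  refine hgeom.trans (le_of_eq ?_)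
  rw [show -B = 1 + -(B + 1) by ring, Real.rpow_add hX0, Real.rpow_one]
  ring

end CutCounting

/-! ### The two-point inequality -/

/-- A second order Taylor estimate; the derivative of the difference has a sign by Bernoulli's
inequality. -/
theorem one_sub_le_one_sub_rpow {a h : ℝ} (ha0 : 0 ≤ a) (ha1 : a ≤ 1) (h0 : 0 ≤ h) (h1 : h ≤ 1) :
    1 - (1 + a) * h + (1 + a) * a * h ^ 2 / 2 ≤ (1 - h) ^ (1 + a) := by
  have key : MonotoneOn
      (fun h : ℝ => (1 - h) ^ (1 + a) - (1 - (1 + a) * h + (1 + a) * a * h ^ 2 / 2))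
      (Set.Icc 0 1) := by
    have hd : ∀ x : ℝ, HasDerivAt
        (fun h : ℝ => (1 - h) ^ (1 + a) - (1 - (1 + a) * h + (1 + a) * a * h ^ 2 / 2))
        ((1 + a) * (1 - a * x - (1 - x) ^ a)) x := by
      intro x
      have e1 : HasDerivAt (fun h : ℝ => 1 - h) (-1) x := by
        simpa using (hasDerivAt_id x).const_sub 1
      have e2 := e1.rpow_const (p := 1 + a) (Or.inr (by linarith))
      have e3 : HasDerivAt (fun h : ℝ => 1 - (1 + a) * h + (1 + a) * a * h ^ 2 / 2)
          (0 - (1 + a) * 1 + (1 + a) * a * (2 * x ^ 1) / 2) x :=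
        ((hasDerivAt_const x (1 : ℝ)).sub ((hasDerivAt_id x).const_mul (1 + a))).add
          (((hasDerivAt_pow 2 x).const_mul ((1 + a) * a)).div_const 2)
      refine (e2.sub e3).congr_deriv ?_
      rw [add_sub_cancel_left]; ring
    apply monotoneOn_of_deriv_nonneg (convex_Icc 0 1)
    · exact fun x _ => (hd x).continuousAt.continuousWithinAt
    · exact fun x _ => (hd x).differentiableAt.differentiableWithinAt
    · intro x hx
      rw [interior_Icc] at hx
      rw [(hd x).deriv]
      have := rpow_one_add_le_one_add_mul_self (s := -x) (by linarith [hx.2]) ha0 ha1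
      have e : (1 : ℝ) + -x = 1 - x := by ring
      rw [e] at this
      apply mul_nonneg (by linarith)
      linarith
  have := key (Set.left_mem_Icc.2 zero_le_one) ⟨h0, h1⟩ h0
  simp at this
  linarith

/-- The one-edge case of the second moment bound. A failing edge contributes `x`, a surviving edge
the smaller value `y`; the left side is the second moment of the conditional mean given whether
the edge is kept. For `y > x` the inequality would be false when `α` is small. -/
theorem two_point {q α x y : ℝ} (hq0 : 0 ≤ q) (hq1 : q ≤ 1) (hα0 : 0 ≤ α) (hα1 : α ≤ 1)
    (hy : 0 ≤ y) (hyx : y ≤ x) :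
    (1 - α) * x ^ 2 + α * (q * x + (1 - q) * y) ^ 2 ≤
      ((1 - α * (1 - q)) * x ^ (2 - q) + α * (1 - q) * y ^ (2 - q)) ^ (2 / (2 - q)) := by
  have hs : 0 < 2 - q := by linarith
  rcases (hy.trans hyx).eq_or_lt with hx | hx
  · have : y = 0 := le_antisymm (hx ▸ hyx) hy
    subst this; subst hx
    simp only [mul_zero, add_zero, ne_eq, OfNat.ofNat_ne_zero, not_false_eq_true, zero_pow]
    have : α * (1 - q) ≤ 1 := mul_le_one₀ hα1 (by linarith) (by linarith)
    refine Real.rpow_nonneg (add_nonneg (mul_nonneg (by linarith) ?_) (mul_nonneg ?_ ?_)) _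
    exacts [by positivity, mul_nonneg hα0 (by linarith), by positivity]
  obtain ⟨t, ht0, ht1, rfl⟩ : ∃ t, 0 ≤ t ∧ t ≤ 1 ∧ y = t * x :=
    ⟨y / x, by positivity, (div_le_one hx).2 hyx, by field_simp⟩
  have hε0 : 0 ≤ α * (1 - q) := mul_nonneg hα0 (by linarith)
  have hε1 : α * (1 - q) ≤ 1 := mul_le_one₀ hα1 (by linarith) (by linarith)
  have h1 := one_sub_le_one_sub_rpow (a := 1 - q) (h := 1 - t) (by linarith) (by linarith)
    (by linarith) (by linarith)
  have e1 : 1 + (1 - q) = 2 - q := by ring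
  have e2 : 1 - (1 - t) = t := by ring
  rw [e1, e2] at h1
  have ht2 : 0 ≤ t ^ (2 - q) := Real.rpow_nonneg ht0 _
  have ht3 : t ^ (2 - q) ≤ 1 := Real.rpow_le_one ht0 ht1 hs.le
  have hd0 : 0 ≤ α * (1 - q) * (1 - t ^ (2 - q)) := mul_nonneg hε0 (by linarith)
  have hd1 : α * (1 - q) * (1 - t ^ (2 - q)) ≤ 1 :=
    mul_le_one₀ hε1 (by linarith) (by linarith)
  have h2 := one_add_mul_self_le_rpow_one_add
    (s := -(α * (1 - q) * (1 - t ^ (2 - q)))) (p := 2 / (2 - q)) (by linarith)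
    ((one_le_div hs).2 (by linarith))
  have h3 : (1 - α) + α * (q + (1 - q) * t) ^ 2 ≤
      (1 + -(α * (1 - q) * (1 - t ^ (2 - q)))) ^ (2 / (2 - q)) := by
    refine le_trans ?_ h2
    have h4 : 2 / (2 - q) * (1 - t ^ (2 - q)) ≤ (1 - t) * (2 - (1 - q) * (1 - t)) := by
      rw [div_mul_eq_mul_div, div_le_iff₀ hs]
      nlinarith
    have := mul_le_mul_of_nonneg_left h4 hε0
    nlinarith
  calc (1 - α) * x ^ 2 + α * (q * x + (1 - q) * (t * x)) ^ 2
      = ((1 - α) + α * (q + (1 - q) * t) ^ 2) * x ^ 2 := by ring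
    _ ≤ (1 + -(α * (1 - q) * (1 - t ^ (2 - q)))) ^ (2 / (2 - q)) * x ^ 2 := by gcongr
    _ = _ := by
      have e3 : x ^ 2 = (x ^ (2 - q)) ^ (2 / (2 - q)) := by
        rw [← Real.rpow_mul hx.le, mul_div_cancel₀ _ hs.ne', Real.rpow_two]
      rw [e3, ← Real.mul_rpow (by linarith) (by positivity), Real.mul_rpow ht0 hx.le]
      congr 1; ring

/-! ### Failing edges and kept edges -/

variable {ε : Type*}

/-- The mean of `f` at the union of `A` and the random set of the edges in the list that survive,
when every edge fails independently with probability `p`. -/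
def failAvg (p : ℝ) (f : Set ε → ℝ) : List ε → Set ε → ℝ
  | [], A => f A
  | e :: l, A => p * failAvg p f l A + (1 - p) * failAvg p f l (insert e A)

/-- The mean of `X` at the random sublist in which every entry of the list is kept independently
with probability `α`. -/
def keepAvg (α : ℝ) : List ε → (List ε → ℝ) → ℝ
  | [], X => X []
  | e :: l, X => α * keepAvg α l (fun l' => X (e :: l')) + (1 - α) * keepAvg α l X

theorem keepAvg_add (α : ℝ) (l : List ε) (X Y : List ε → ℝ) :
    keepAvg α l (fun l' => X l' + Y l') = keepAvg α l X + keepAvg α l Y := by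
  induction l generalizing X Y with
  | nil => rfl
  | cons e l ih => simp only [keepAvg, ih]; ring

theorem keepAvg_const_mul (α c : ℝ) (l : List ε) (X : List ε → ℝ) :
    keepAvg α l (fun l' => c * X l') = c * keepAvg α l X := by
  induction l generalizing X with
  | nil => rfl
  | cons e l ih => simp only [keepAvg, ih]; ring

theorem keepAvg_const (α c : ℝ) (l : List ε) : keepAvg α l (fun _ => c) = c := by
  induction l with
  | nil => rfl
  | cons e l ih => simp only [keepAvg, ih]; ring

theorem keepAvg_sum {ι : Type*} (α : ℝ) (l : List ε) (s : Finset ι) (X : ι → List ε → ℝ) :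
    keepAvg α l (fun l' => ∑ i ∈ s, X i l') = ∑ i ∈ s, keepAvg α l (X i) := by
  classical
  induction s using Finset.induction_on with
  | empty => simpa using keepAvg_const α 0 l
  | insert i s hi ih => simp only [Finset.sum_insert hi, keepAvg_add, ih]

theorem keepAvg_mono {α : ℝ} (h0 : 0 ≤ α) (h1 : α ≤ 1) (l : List ε) {X Y : List ε → ℝ}
    (h : ∀ l', X l' ≤ Y l') : keepAvg α l X ≤ keepAvg α l Y := by
  induction l generalizing X Y with
  | nil => exact h _
  | cons e l ih =>
    have h2 : 0 ≤ 1 - α := by linarith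
    exact add_le_add (mul_le_mul_of_nonneg_left (ih fun l' => h _) h0)
      (mul_le_mul_of_nonneg_left (ih h) h2)

theorem keepAvg_nonneg {α : ℝ} (h0 : 0 ≤ α) (h1 : α ≤ 1) (l : List ε) {X : List ε → ℝ}
    (h : ∀ l', 0 ≤ X l') : 0 ≤ keepAvg α l X :=
  (keepAvg_const α 0 l).symm.le.trans (keepAvg_mono h0 h1 l h)

/-- The whole list is kept with probability `α` to the power of its length. -/
theorem pow_length_mul_le_keepAvg {α : ℝ} (h0 : 0 ≤ α) (h1 : α ≤ 1) (l : List ε)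
    {X : List ε → ℝ} (h : ∀ l', 0 ≤ X l') : α ^ l.length * X l ≤ keepAvg α l X := by
  induction l generalizing X with
  | nil => simp [keepAvg]
  | cons e l ih =>
    have h3 := ih (X := fun l' => X (e :: l')) fun l' => h _
    have h4 := mul_nonneg (sub_nonneg.2 h1) (keepAvg_nonneg h0 h1 l h)
    have h5 := mul_le_mul_of_nonneg_left h3 h0
    simp only [keepAvg, List.length_cons, pow_succ]
    linarith

/-- The Cauchy-Schwarz inequality. -/
theorem keepAvg_mul_sq_le {α : ℝ} (h0 : 0 ≤ α) (h1 : α ≤ 1) (l : List ε) (X Y : List ε → ℝ) :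
    keepAvg α l (fun l' => X l' * Y l') ≤
      √(keepAvg α l fun l' => X l' ^ 2) * √(keepAvg α l fun l' => Y l' ^ 2) := by
  induction l generalizing X Y with
  | nil =>
    simp only [keepAvg, Real.sqrt_sq_eq_abs, ← abs_mul]
    exact le_abs_self _
  | cons e l ih =>
    simp only [keepAvg]
    have n1 := keepAvg_nonneg h0 h1 l (X := fun l' => X (e :: l') ^ 2) fun _ => sq_nonneg _
    have n2 := keepAvg_nonneg h0 h1 l (X := fun l' => X l' ^ 2) fun _ => sq_nonneg _
    have n3 := keepAvg_nonneg h0 h1 l (X := fun l' => Y (e :: l') ^ 2) fun _ => sq_nonneg _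
    have n4 := keepAvg_nonneg h0 h1 l (X := fun l' => Y l' ^ 2) fun _ => sq_nonneg _
    have i1 := ih (fun l' => X (e :: l')) (fun l' => Y (e :: l'))
    have i2 := ih X Y
    generalize keepAvg α l (fun l' => X (e :: l') ^ 2) = a1 at *
    generalize keepAvg α l (fun l' => X l' ^ 2) = a2 at *
    generalize keepAvg α l (fun l' => Y (e :: l') ^ 2) = b1 at *
    generalize keepAvg α l (fun l' => Y l' ^ 2) = b2 at *
    have hβ : 0 ≤ 1 - α := by linarith
    refine (add_le_add (mul_le_mul_of_nonneg_left i1 h0)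
      (mul_le_mul_of_nonneg_left i2 hβ)).trans ?_
    rw [← Real.sqrt_mul (x := α * a1 + (1 - α) * a2) (by positivity)]
    apply Real.le_sqrt_of_sq_le
    rw [← Real.sq_sqrt n1, ← Real.sq_sqrt n2, ← Real.sq_sqrt n3, ← Real.sq_sqrt n4]
    simp only [Real.sqrt_sq (Real.sqrt_nonneg _)]
    nlinarith [mul_nonneg (mul_nonneg h0 hβ) (sq_nonneg (√a1 * √b2 - √a2 * √b1))]

/-- Keeping an edge with probability `α` and then letting it fail with probability `q` makes it
survive with probability `α (1 - q)`. -/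
theorem keepAvg_failAvg (α q : ℝ) (f : Set ε → ℝ) (l : List ε) (A : Set ε) :
    keepAvg α l (fun l' => failAvg q f l' A) = failAvg (1 - α * (1 - q)) f l A := by
  induction l generalizing A with
  | nil => rfl
  | cons e l ih =>
    simp only [keepAvg, failAvg, keepAvg_add, keepAvg_const_mul, ih]
    ring

theorem failAvg_nonneg {p : ℝ} (h0 : 0 ≤ p) (h1 : p ≤ 1) {f : Set ε → ℝ} (hf : ∀ A, 0 ≤ f A)
    (l : List ε) (A : Set ε) : 0 ≤ failAvg p f l A := by
  induction l generalizing A with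
  | nil => exact hf A
  | cons e l ih =>
    exact add_nonneg (mul_nonneg h0 (ih _)) (mul_nonneg (sub_nonneg.2 h1) (ih _))

theorem failAvg_mono {p : ℝ} (h0 : 0 ≤ p) (h1 : p ≤ 1) {f g : Set ε → ℝ} (h : ∀ A, f A ≤ g A)
    (l : List ε) (A : Set ε) : failAvg p f l A ≤ failAvg p g l A := by
  induction l generalizing A with
  | nil => exact h A
  | cons e l ih =>
    exact add_le_add (mul_le_mul_of_nonneg_left (ih _) h0)
      (mul_le_mul_of_nonneg_left (ih _) (sub_nonneg.2 h1))

theorem failAvg_antitone {p : ℝ} (h0 : 0 ≤ p) (h1 : p ≤ 1) {f : Set ε → ℝ} (hf : Antitone f)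
    (l : List ε) : Antitone (failAvg p f l) := by
  induction l with
  | nil => exact hf
  | cons e l ih =>
    intro A B hAB
    exact add_le_add (mul_le_mul_of_nonneg_left (ih hAB) h0)
      (mul_le_mul_of_nonneg_left (ih (Set.insert_subset_insert hAB)) (sub_nonneg.2 h1))

theorem failAvg_const (p c : ℝ) (l : List ε) (A : Set ε) : failAvg p (fun _ => c) l A = c := by
  induction l generalizing A with
  | nil => rfl
  | cons e l ih => simp only [failAvg, ih]; ring

theorem failAvg_sum {ι : Type*} (p : ℝ) (s : Finset ι) (f : ι → Set ε → ℝ) (l : List ε)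
    (A : Set ε) : failAvg p (fun A => ∑ i ∈ s, f i A) l A = ∑ i ∈ s, failAvg p (f i) l A := by
  induction l generalizing A with
  | nil => rfl
  | cons e l ih => simp only [failAvg, ih, Finset.sum_add_distrib, Finset.mul_sum]

/-- The edges with the property `Q` all fail with probability `p` to the power of their number. -/
theorem failAvg_forall_not (p : ℝ) (Q : ε → Prop) [DecidablePred Q]
    [DecidablePred fun A : Set ε => ∀ e ∈ A, ¬ Q e] (l : List ε) (A : Set ε) :
    failAvg p (fun A => if ∀ e ∈ A, ¬ Q e then 1 else 0) l A =
      if ∀ e ∈ A, ¬ Q e then p ^ l.countP (fun e => Q e) else 0 := by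
  induction l generalizing A with
  | nil => simp [failAvg]
  | cons e l ih =>
    simp only [failAvg, ih, List.countP_cons]
    by_cases hA : ∀ e ∈ A, ¬ Q e
    · by_cases he : Q e
      · rw [if_pos hA, if_neg fun h => h e (Set.mem_insert e A) he, if_pos hA]
        simp only [he, decide_true, if_true, pow_succ]
        ring
      · rw [if_pos hA, if_pos (by rintro x (rfl | hx); exacts [he, hA x hx]), if_pos hA]
        simp only [he, decide_false, Bool.false_eq_true, if_false, add_zero]
        ring
    · rw [if_neg hA, if_neg fun h => hA fun e' he' => h e' (Set.mem_insert_of_mem _ he'), if_neg hA]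
      ring

/-- Hypercontractivity: the conditional mean of a monotone function given the kept edges has its
second moment bounded by an `L^s`-norm with `s = 2 - q`. The induction over the edges splits off
one edge at a time, with the Cauchy-Schwarz inequality for the cross term. -/
theorem keepAvg_failAvg_sq_le {α q : ℝ} (hq0 : 0 ≤ q) (hq1 : q ≤ 1) (hα0 : 0 ≤ α) (hα1 : α ≤ 1)
    {f : Set ε → ℝ} (hf : ∀ A, 0 ≤ f A) (hanti : Antitone f) (l : List ε) (A : Set ε) :
    keepAvg α l (fun l' => failAvg q f l' A ^ 2) ≤
      failAvg (1 - α * (1 - q)) (fun A => f A ^ (2 - q)) l A ^ (2 / (2 - q)) := by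
  have hs : 0 < 2 - q := by linarith
  induction l generalizing A with
  | nil =>
    simp only [keepAvg, failAvg]
    rw [← Real.rpow_mul (hf A), mul_div_cancel₀ _ hs.ne', Real.rpow_two]
  | cons e l ih =>
    have hε0 : 0 ≤ α * (1 - q) := mul_nonneg hα0 (by linarith)
    have hε1 : α * (1 - q) ≤ 1 := mul_le_one₀ hα1 (by linarith) (by linarith)
    have hfs : ∀ A, 0 ≤ f A ^ (2 - q) := fun A => Real.rpow_nonneg (hf A) _
    have nX := keepAvg_nonneg hα0 hα1 l (X := fun l' => failAvg q f l' A ^ 2)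
      fun _ => sq_nonneg _
    have nY := keepAvg_nonneg hα0 hα1 l (X := fun l' => failAvg q f l' (insert e A) ^ 2)
      fun _ => sq_nonneg _
    -- the survival of `e` can only decrease `f`, so that the two-point inequality applies
    have hYX : keepAvg α l (fun l' => failAvg q f l' (insert e A) ^ 2) ≤
        keepAvg α l (fun l' => failAvg q f l' A ^ 2) :=
      keepAvg_mono hα0 hα1 l fun l' => pow_le_pow_left₀ (failAvg_nonneg hq0 hq1 hf _ _)
        (failAvg_antitone hq0 hq1 hanti l' (Set.subset_insert e A)) 2
    have hCS := keepAvg_mul_sq_le hα0 hα1 l (fun l' => failAvg q f l' A)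
      (fun l' => failAvg q f l' (insert e A))
    have hexp : keepAvg α (e :: l) (fun l' => failAvg q f l' A ^ 2) =
        (1 - α) * keepAvg α l (fun l' => failAvg q f l' A ^ 2) +
        α * (q ^ 2 * keepAvg α l (fun l' => failAvg q f l' A ^ 2) +
          2 * q * (1 - q) *
            keepAvg α l (fun l' => failAvg q f l' A * failAvg q f l' (insert e A)) +
          (1 - q) ^ 2 * keepAvg α l (fun l' => failAvg q f l' (insert e A) ^ 2)) := by
      simp only [keepAvg, failAvg, ← keepAvg_const_mul, ← keepAvg_add]
      congr 1
      funext l'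
      ring
    rw [hexp]
    have hX := ih A
    have hY := ih (insert e A)
    generalize keepAvg α l (fun l' => failAvg q f l' A ^ 2) = x2 at *
    generalize keepAvg α l (fun l' => failAvg q f l' (insert e A) ^ 2) = y2 at *
    generalize keepAvg α l (fun l' => failAvg q f l' A * failAvg q f l' (insert e A)) = xy at *
    have hroot : ∀ {z u : ℝ}, 0 ≤ z → 0 ≤ u → z ≤ u ^ (2 / (2 - q)) → √z ^ (2 - q) ≤ u := by
      intro z u hz hu h
      rw [Real.sqrt_eq_rpow, ← Real.rpow_mul hz]
      calc z ^ (1 / 2 * (2 - q)) ≤ (u ^ (2 / (2 - q))) ^ (1 / 2 * (2 - q)) :=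
            Real.rpow_le_rpow hz h (by positivity)
        _ = u := by
          rw [← Real.rpow_mul hu, show 2 / (2 - q) * (1 / 2 * (2 - q)) = 1 by field_simp,
            Real.rpow_one]
    have hp0 : 0 ≤ 1 - α * (1 - q) := by linarith
    have hp1 : 1 - α * (1 - q) ≤ 1 := by linarith
    have hX' := hroot nX (failAvg_nonneg hp0 hp1 hfs l A) hX
    have hY' := hroot nY (failAvg_nonneg hp0 hp1 hfs l _) hY
    have h2 := two_point hq0 hq1 hα0 hα1 (Real.sqrt_nonneg y2) (Real.sqrt_le_sqrt hYX)
    calc _ ≤ (1 - α) * √x2 ^ 2 + α * (q * √x2 + (1 - q) * √y2) ^ 2 := by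
          have h3 := mul_le_mul_of_nonneg_left hCS
            (show 0 ≤ α * (2 * q * (1 - q)) from
              mul_nonneg hα0 (mul_nonneg (by linarith) (by linarith)))
          have h4 := Real.sq_sqrt nX
          have h5 := Real.sq_sqrt nY
          linear_combination h3 - (1 - α + α * q ^ 2) * h4 - α * (1 - q) ^ 2 * h5
      _ ≤ _ := h2
      _ ≤ _ := by
        refine Real.rpow_le_rpow ?_ ?_ (by positivity)
        · have := Real.rpow_nonneg (Real.sqrt_nonneg x2) (2 - q)
          have := Real.rpow_nonneg (Real.sqrt_nonneg y2) (2 - q)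
          positivity
        · simp only [failAvg, sub_sub_cancel]
          exact add_le_add (mul_le_mul_of_nonneg_left hX' hp0) (mul_le_mul_of_nonneg_left hY' hε0)

/-! ### Concentration -/

/-- The moment generating function of a binomial random variable. -/
theorem keepAvg_exp_countP (α t : ℝ) (Q : ε → Bool) (l : List ε) :
    keepAvg α l (fun l' => Real.exp (t * l'.countP Q)) =
      (1 + α * (Real.exp t - 1)) ^ l.countP Q := by
  induction l with
  | nil => simp [keepAvg]
  | cons e l ih =>
    by_cases he : Q e
    · simp only [keepAvg, List.countP_cons, he, if_true, Nat.cast_add, Nat.cast_one, mul_add,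
        mul_one, Real.exp_add, mul_comm _ (Real.exp t), keepAvg_const_mul, ih, pow_succ]
      ring
    · simp only [keepAvg, List.countP_cons, he, Bool.false_eq_true, if_false, add_zero, ih]
      ring

open Classical in
/-- Chernoff's bound. -/
theorem keepAvg_countP_deviation_le {α δ : ℝ} (hα0 : 0 ≤ α) (hα1 : α ≤ 1) (hδ0 : 0 ≤ δ)
    (hδ1 : δ ≤ 1) (Q : ε → Bool) (l : List ε) :
    keepAvg α l (fun l' => if (1 - δ) * α * l.countP Q ≤ l'.countP Q ∧
        (l'.countP Q : ℝ) ≤ (1 + δ) * α * l.countP Q then 0 else 1) ≤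
      2 * Real.exp (-(α * δ ^ 2 / 4) * l.countP Q) := by
  set d := l.countP Q with hd
  -- Markov's inequality for `exp (t X)` gives the two tails, with `t = δ / 2` and `t = -δ / 2`
  have tail : ∀ t : ℝ, |t| ≤ 1 → ∀ s : ℝ,
      keepAvg α l (fun l' => Real.exp (-s) * Real.exp (t * l'.countP Q)) ≤
        Real.exp (α * d * (t + t ^ 2) - s) := by
    intro t ht s
    rw [keepAvg_const_mul, keepAvg_exp_countP, sub_eq_add_neg (α * d * (t + t ^ 2)), Real.exp_add,
      mul_comm]
    refine mul_le_mul_of_nonneg_right ?_ (Real.exp_pos _).le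
    have h1 := (abs_le.1 (Real.abs_exp_sub_one_sub_id_le ht)).2
    have h2 : 1 + α * (Real.exp t - 1) ≤ Real.exp (α * (t + t ^ 2)) := by
      have h3 := Real.add_one_le_exp (α * (t + t ^ 2))
      have h4 := mul_le_mul_of_nonneg_left h1 hα0
      nlinarith
    have h5 : 0 ≤ 1 + α * (Real.exp t - 1) := by nlinarith [Real.exp_pos t]
    calc _ ≤ Real.exp (α * (t + t ^ 2)) ^ d := pow_le_pow_left₀ h5 h2 d
      _ = _ := by rw [← Real.exp_nat_mul]; congr 1; ring
  have habs : |δ / 2| ≤ 1 := by rw [abs_le]; constructor <;> linarith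
  have hu := tail (δ / 2) habs (δ / 2 * ((1 + δ) * α * d))
  have hl := tail (-(δ / 2)) (by rwa [abs_neg]) (-(δ / 2) * ((1 - δ) * α * d))
  have hsum : 2 * Real.exp (-(α * δ ^ 2 / 4) * d) =
      Real.exp (α * d * (δ / 2 + (δ / 2) ^ 2) - δ / 2 * ((1 + δ) * α * d)) +
      Real.exp (α * d * (-(δ / 2) + (-(δ / 2)) ^ 2) - -(δ / 2) * ((1 - δ) * α * d)) := by
    rw [two_mul]; congr 2 <;> ring
  rw [hsum]
  refine le_trans ?_ (add_le_add hu hl)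
  rw [← keepAvg_add]
  refine keepAvg_mono hα0 hα1 l fun l' => ?_
  simp only [← Real.exp_add]
  split_ifs with h
  · positivity
  · rw [not_and_or, not_le, not_le] at h
    rcases h with h | h
    · refine le_add_of_nonneg_of_le (Real.exp_pos _).le (Real.one_le_exp ?_)
      nlinarith
    · refine le_add_of_le_of_nonneg (Real.one_le_exp ?_) (Real.exp_pos _).le
      nlinarith

/-! ### Multigraphs as edge lists -/

section EdgeLists

variable {n : ℕ}

namespace Multigraph

/-- The multigraph with the given list of edges. -/
def ofList (l : List (Fin n × Fin n)) : Multigraph n := ⟨l.length, l.get⟩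

/-- The edges in the order of the input. -/
def edgeList (G : Multigraph n) : List (Fin n × Fin n) := List.ofFn G.ends

@[simp]
theorem edgeList_ofList (l : List (Fin n × Fin n)) : (ofList l).edgeList = l := List.ofFn_get l

theorem length_edgeList (G : Multigraph n) : G.edgeList.length = G.m := List.length_ofFn

theorem isSubgraph_ofList {G : Multigraph n} {l : List (Fin n × Fin n)}
    (h : l.Sublist G.edgeList) : (ofList l).IsSubgraph G := by
  obtain ⟨f, hf⟩ := List.sublist_iff_exists_fin_orderEmbedding_get_eq.1 h
  refine ⟨fun e => Fin.cast G.length_edgeList (f e), fun x y hxy => f.injective ?_, fun e => ?_⟩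
  · simpa using hxy
  · refine (hf e).trans ?_
    simp [edgeList, Fin.cast]

end Multigraph

/-- The edge `e` has exactly one endpoint in `S`. -/
def crosses (S : Finset (Fin n)) (e : Fin n × Fin n) : Prop := ¬ (e.1 ∈ S ↔ e.2 ∈ S)

instance (S : Finset (Fin n)) : DecidablePred (crosses S) := fun e =>
  inferInstanceAs (Decidable (¬ (e.1 ∈ S ↔ e.2 ∈ S)))

theorem Multigraph.card_boundary (G : Multigraph n) (S : Finset (Fin n)) :
    (G.boundary S).card = G.edgeList.countP (crosses S) := by
  rw [Multigraph.edgeList, List.ofFn_eq_map, List.countP_map, List.countP_eq_length_filter]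
  rfl

/-- The nonempty proper vertex sets. -/
def properSets (n : ℕ) : Finset (Finset (Fin n)) :=
  Finset.univ.filter fun S => S.Nonempty ∧ S ≠ Finset.univ

theorem mem_properSets {S : Finset (Fin n)} :
    S ∈ properSets n ↔ S.Nonempty ∧ S ≠ Finset.univ := by simp [properSets]

theorem Multigraph.minCut_le (G : Multigraph n) {S : Finset (Fin n)} (hS : S ∈ properSets n) :
    G.minCut ≤ (G.boundary S).card :=
  Nat.sInf_le ⟨_, Finset.mem_coe.2 (Finset.mem_image_of_mem _ hS), rfl⟩

theorem properSets_nonempty (hn : 2 ≤ n) : (properSets n).Nonempty := by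
  refine ⟨{⟨0, by omega⟩}, mem_properSets.2 ⟨Finset.singleton_nonempty _, fun h => ?_⟩⟩
  have := congrArg Finset.card h
  rw [Finset.card_singleton, Finset.card_univ, Fintype.card_fin] at this
  omega

theorem Multigraph.exists_card_boundary_eq_minCut (G : Multigraph n) (hn : 2 ≤ n) :
    ∃ S ∈ properSets n, (G.boundary S).card = G.minCut := by
  obtain ⟨T, hT⟩ := properSets_nonempty hn
  have hne : (Finset.card '' (G.cuts : Set (Finset (Fin G.m)))).Nonempty :=
    ⟨_, _, Finset.mem_coe.2 (Finset.mem_image_of_mem _ hT), rfl⟩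
  obtain ⟨D, hD, hD'⟩ := Nat.sInf_mem hne
  obtain ⟨S, hS, rfl⟩ := Finset.mem_image.1 (Finset.mem_coe.1 hD)
  exact ⟨S, hS, hD'⟩

open Classical in
/-- The indicator of the event that the edges in `A` leave the vertex set disconnected. -/
def disconnected (A : Set (Fin n × Fin n)) : ℝ :=
  if (SimpleGraph.fromRel fun u v => (u, v) ∈ A).Connected then 0 else 1

theorem disconnected_nonneg (A : Set (Fin n × Fin n)) : 0 ≤ disconnected A := by
  unfold disconnected; split_ifs <;> norm_num

theorem disconnected_le_one (A : Set (Fin n × Fin n)) : disconnected A ≤ 1 := by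
  unfold disconnected; split_ifs <;> norm_num

theorem disconnected_rpow (A : Set (Fin n × Fin n)) {s : ℝ} (hs : 0 < s) :
    disconnected A ^ s = disconnected A := by
  unfold disconnected
  split_ifs
  · rw [Real.zero_rpow hs.ne']
  · rw [Real.one_rpow]

theorem disconnected_antitone : Antitone (disconnected (n := n)) := by
  intro A B hAB
  unfold disconnected
  by_cases hA : (SimpleGraph.fromRel fun u v => (u, v) ∈ A).Connected
  · rw [if_pos hA, if_pos]
    refine hA.mono fun u v h => ?_
    rw [SimpleGraph.fromRel_adj] at h ⊢
    exact ⟨h.1, h.2.imp (fun h => hAB h) fun h => hAB h⟩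
  · rw [if_neg hA]
    split_ifs <;> norm_num

theorem disconnected_eq_one {A : Set (Fin n × Fin n)} {S : Finset (Fin n)}
    (hS : S ∈ properSets n) (h : ∀ e ∈ A, ¬ crosses S e) : disconnected A = 1 := by
  rw [disconnected, if_neg]
  intro hc
  obtain ⟨⟨u, hu⟩, hne⟩ := mem_properSets.1 hS
  refine hne (Finset.eq_univ_of_forall fun v => ?_)
  obtain ⟨w⟩ := hc.preconnected u v
  induction w with
  | nil => exact hu
  | cons hadj _ ih =>
    refine ih ?_
    obtain ⟨-, h1 | h1⟩ := (SimpleGraph.fromRel_adj _ _ _).1 hadj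
    · have := h _ h1; simp only [crosses, not_not] at this; exact this.1 hu
    · have := h _ h1; simp only [crosses, not_not] at this; exact this.2 hu

theorem exists_not_crosses_of_disconnected (hn : 1 ≤ n) {A : Set (Fin n × Fin n)}
    (h : disconnected A ≠ 0) : ∃ S ∈ properSets n, ∀ e ∈ A, ¬ crosses S e := by
  classical
  have hc : ¬ (SimpleGraph.fromRel fun u v => (u, v) ∈ A).Connected := by
    intro hc; rw [disconnected, if_pos hc] at h; exact h rfl
  set Γ := SimpleGraph.fromRel fun u v => (u, v) ∈ A with hΓ
  have : ∃ u v, ¬ Γ.Reachable u v := by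
    by_contra hcon
    push Not at hcon
    exact hc { preconnected := hcon, nonempty := ⟨⟨0, hn⟩⟩ }
  obtain ⟨u, v, huv⟩ := this
  -- the component of `u`
  refine ⟨Finset.univ.filter (Γ.Reachable u), mem_properSets.2
    ⟨⟨u, Finset.mem_filter.2 ⟨Finset.mem_univ _, SimpleGraph.Reachable.refl u⟩⟩, fun hu => ?_⟩,
    fun e he => ?_⟩
  · have hv : v ∈ Finset.univ.filter (Γ.Reachable u) := by
      rw [hu]; exact Finset.mem_univ v
    exact huv (Finset.mem_filter.1 hv).2
  · simp only [crosses, not_not, Finset.mem_filter, Finset.mem_univ, true_and]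
    by_cases h12 : e.1 = e.2
    · rw [h12]
    · have hadj : Γ.Adj e.1 e.2 := (SimpleGraph.fromRel_adj _ _ _).2 ⟨h12, Or.inl he⟩
      exact ⟨fun h => h.trans hadj.reachable, fun h => h.trans hadj.symm.reachable⟩

/-- The recursion over the edges agrees with the sum over the sets `F` of failing edges. -/
theorem sum_powerset_eq_failAvg {ι ε : Type*} [DecidableEq ι] (p : ℝ) (ends : ι → ε)
    (f : Set ε → ℝ) (l : List ι) (hl : l.Nodup) (A : Set ε) :
    ∑ F ∈ l.toFinset.powerset, p ^ F.card * (1 - p) ^ (l.toFinset \ F).card *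
      f (ends '' (l.toFinset \ F : Finset ι) ∪ A) = failAvg p f (l.map ends) A := by
  induction l generalizing A with
  | nil => simp [failAvg]
  | cons i l ih =>
    obtain ⟨hi, hl⟩ := List.nodup_cons.1 hl
    have hi' : i ∉ l.toFinset := by simpa using hi
    rw [List.toFinset_cons, Finset.sum_powerset_insert hi', List.map_cons, failAvg, ← ih hl,
      ← ih hl, Finset.mul_sum, Finset.mul_sum, add_comm]
    congr 1
    · refine Finset.sum_congr rfl fun F hF => ?_
      have hiF : i ∉ F := fun h => hi' (Finset.mem_powerset.1 hF h)
      have : insert i l.toFinset \ insert i F = l.toFinset \ F := by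
        rw [Finset.insert_sdiff_insert, Finset.sdiff_insert_of_notMem hi']
      rw [this, Finset.card_insert_of_notMem hiF, pow_succ]
      ring
    · refine Finset.sum_congr rfl fun F hF => ?_
      have hiF : i ∉ F := fun h => hi' (Finset.mem_powerset.1 hF h)
      rw [Finset.insert_sdiff_of_notMem _ hiF, Finset.card_insert_of_notMem
        (fun h => hi' (Finset.mem_sdiff.1 h).1), pow_succ, Finset.coe_insert, Set.image_insert_eq,
        Set.insert_union, Set.union_insert]
      ring

theorem Multigraph.unreliability_eq (G : Multigraph n) (p : ℝ) :
    G.unreliability p = failAvg p disconnected G.edgeList ∅ := by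
  classical
  rw [Multigraph.edgeList, List.ofFn_eq_map,
    ← sum_powerset_eq_failAvg p G.ends disconnected _ (List.nodup_finRange _) ∅, unreliability]
  rw [List.toFinset_finRange, Finset.powerset_univ]
  refine Finset.sum_congr rfl fun F _ => ?_
  rw [← Finset.compl_eq_univ_sdiff, Set.union_empty]
  have : G.adjVia Fᶜ = SimpleGraph.fromRel fun u v => (u, v) ∈ G.ends '' (Fᶜ : Finset _) := rfl
  rw [this, disconnected]
  split_ifs <;> simp

theorem Multigraph.unreliability_nonneg (G : Multigraph n) {p : ℝ} (h0 : 0 ≤ p) (h1 : p ≤ 1) :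
    0 ≤ G.unreliability p := by
  rw [unreliability_eq]
  exact failAvg_nonneg h0 h1 disconnected_nonneg _ _

theorem Multigraph.unreliability_le_one (G : Multigraph n) {p : ℝ} (h0 : 0 ≤ p) (h1 : p ≤ 1) :
    G.unreliability p ≤ 1 := by
  rw [unreliability_eq, ← failAvg_const p 1 G.edgeList ∅]
  exact failAvg_mono h0 h1 disconnected_le_one _ _

/-- `G` is disconnected when a given cut fails. -/
theorem Multigraph.pow_card_boundary_le_unreliability (G : Multigraph n) {p : ℝ} (h0 : 0 ≤ p)
    (h1 : p ≤ 1) {S : Finset (Fin n)} (hS : S ∈ properSets n) :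
    p ^ (G.boundary S).card ≤ G.unreliability p := by
  classical
  have h := failAvg_forall_not p (crosses S) G.edgeList ∅
  rw [if_pos (by simp)] at h
  rw [unreliability_eq, card_boundary]
  refine le_trans (le_of_eq ?_) ((failAvg_mono h0 h1 (f := fun A =>
    if ∀ e ∈ A, ¬ crosses S e then 1 else 0) (fun A => ?_) _ _))
  · rw [h]
  · split_ifs with hA
    · exact (disconnected_eq_one hS hA).ge
    · exact disconnected_nonneg A

/-- The union bound over the cuts. -/
theorem Multigraph.unreliability_le_sum (G : Multigraph n) (hn : 1 ≤ n) {p : ℝ} (h0 : 0 ≤ p)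
    (h1 : p ≤ 1) : G.unreliability p ≤ ∑ S ∈ properSets n, p ^ (G.boundary S).card := by
  classical
  have h : ∀ S, failAvg p (fun A => if ∀ e ∈ A, ¬ crosses S e then 1 else 0) G.edgeList ∅ =
      p ^ (G.boundary S).card := by
    intro S
    rw [failAvg_forall_not p (crosses S) G.edgeList ∅, if_pos (by simp), card_boundary]
  rw [unreliability_eq]
  simp only [← h]
  rw [← failAvg_sum]
  refine failAvg_mono h0 h1 (fun A => ?_) _ _
  have hnn : ∀ S ∈ properSets n, (0 : ℝ) ≤ if ∀ e ∈ A, ¬ crosses S e then 1 else 0 := by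
    intro S _; split_ifs <;> norm_num
  by_cases hA : disconnected A = 0
  · rw [hA]; exact Finset.sum_nonneg hnn
  · obtain ⟨S, hS, hS'⟩ := exists_not_crosses_of_disconnected hn hA
    refine (disconnected_le_one A).trans (le_trans ?_ (Finset.single_le_sum hnn hS))
    rw [if_pos hS']

end EdgeLists

/-! ### The law of the random sublist -/

theorem flip_true_toReal {r : ℝ} (h0 : 0 ≤ r) (h1 : r ≤ 1) : (flip r true).toReal = r := by
  have : r.toNNReal ≤ 1 := by rwa [Real.toNNReal_le_one]
  simp [flip, min_eq_left this, h0]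

theorem flip_false_toReal {r : ℝ} (h0 : 0 ≤ r) (h1 : r ≤ 1) :
    (flip r false).toReal = 1 - r := by
  have h : r.toNNReal ≤ 1 := by rwa [Real.toNNReal_le_one]
  have h2 : (r.toNNReal : ℝ≥0∞) ≤ 1 := by exact_mod_cast h
  simp [flip, min_eq_left h, ENNReal.toReal_sub_of_le h2, h0]

/-- The law of the random sublist in which every entry of the list is kept independently with
probability `α`. -/
def keepLaw {ε : Type*} (α : ℝ) : List ε → PMF (List ε)
  | [] => PMF.pure []
  | e :: l => (flip α).bind fun b => (keepLaw α l).map fun l' => if b then e :: l' else l'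

theorem sublist_of_mem_support_keepLaw {ε : Type*} {α : ℝ} {l l' : List ε}
    (h : l' ∈ (keepLaw α l).support) : l'.Sublist l := by
  induction l generalizing l' with
  | nil => simp [keepLaw] at h; rw [h]
  | cons e l ih =>
    simp only [keepLaw, PMF.mem_support_bind_iff, PMF.mem_support_map_iff] at h
    obtain ⟨b, -, l'', h1, rfl⟩ := h
    cases b
    · exact (ih h1).cons e
    · exact (ih h1).cons_cons e

theorem finite_support_map_keepLaw {ε Ω : Type*} (α : ℝ) (l : List ε) (g : List ε → Ω) :
    ((keepLaw α l).map g).support.Finite := by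
  rw [PMF.support_map]
  exact Set.Finite.image _ ((List.finite_toSet l.sublists).subset fun l' h =>
    List.mem_sublists.2 (sublist_of_mem_support_keepLaw h))

theorem expect_map_keepLaw {ε Ω : Type*} {α : ℝ} (h0 : 0 ≤ α) (h1 : α ≤ 1) (l : List ε)
    (g : List ε → Ω) (X : Ω → ℝ) :
    expect ((keepLaw α l).map g) X = keepAvg α l (fun l' => X (g l')) := by
  induction l generalizing g with
  | nil =>
    rw [keepLaw, PMF.pure_map, expect, tsum_eq_single (g [])]
    · simp [keepAvg]
    · intro ω hω
      simp [PMF.pure_apply, hω]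
  | cons e l ih =>
    have key : ∀ ω, (((keepLaw α (e :: l)).map g) ω).toReal * X ω =
        α * ((((keepLaw α l).map fun l' => g (e :: l')) ω).toReal * X ω) +
        (1 - α) * ((((keepLaw α l).map g) ω).toReal * X ω) := by
      intro ω
      have : ((keepLaw α (e :: l)).map g) ω =
          flip α true * ((keepLaw α l).map fun l' => g (e :: l')) ω +
          flip α false * ((keepLaw α l).map g) ω := by
        rw [keepLaw, PMF.map_bind, PMF.bind_apply, tsum_bool, add_comm]
        simp [PMF.map_comp, Function.comp_def]
      rw [this, ENNReal.toReal_add (ENNReal.mul_ne_top (PMF.apply_ne_top _ _)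
        (PMF.apply_ne_top _ _)) (ENNReal.mul_ne_top (PMF.apply_ne_top _ _)
        (PMF.apply_ne_top _ _)), ENNReal.toReal_mul, ENNReal.toReal_mul, flip_true_toReal h0 h1,
        flip_false_toReal h0 h1]
      ring
    have hsum : ∀ g : List ε → Ω,
        Summable fun ω => (((keepLaw α l).map g) ω).toReal * X ω := by
      intro g
      refine summable_of_hasFiniteSupport ((finite_support_map_keepLaw α l g).subset fun ω h => ?_)
      rw [PMF.mem_support_iff]
      intro h'
      rw [Function.mem_support, h'] at h
      simp at h
    rw [expect]
    simp only [key]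
    rw [((hsum _).mul_left α).tsum_add ((hsum _).mul_left (1 - α)), tsum_mul_left, tsum_mul_left,
      keepAvg, ← ih, ← ih]
    rfl

open Classical in
theorem prob_eq_expect {Ω : Type*} (μ : PMF Ω) (A : Set Ω) :
    prob μ A = expect μ (fun ω => if ω ∈ A then 1 else 0) := by
  rw [prob, PMF.toOuterMeasure_apply, ENNReal.tsum_toReal_eq, expect]
  · refine tsum_congr fun ω => ?_
    by_cases h : ω ∈ A <;> simp [h]
  · intro ω
    by_cases h : ω ∈ A <;> simp [h, PMF.apply_ne_top]

/-! ### The program -/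

/-- The program. Its first loop computes `L = ⌈log₂ n⌉` and `B ^ L`; the straight-line part computes
`q` and the keeping probability `α = (1 - p) / (1 - q)`; the last loop copies every edge to the
next free place of the output, which moves on when the coin shows that the edge is kept. -/
def sparsify (A B : ℕ) : Program :=
  [.const 2 1, .const 4 1, .const 7 B, .rcast 1 2, .rcast 2 7, .rcast 3 2,
    -- instruction 6: `reg 3` counts the doublings of `reg 4` until it reaches `n`
    .add 4 4 4, .add 3 3 2, .rmul 1 1 2, .jlt 4 0 6,
    -- instruction 10: `rreg 5 := 1 - 1 / (A L ^ 3)`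
    .const 7 A, .rcast 4 7, .rcast 5 3, .rmul 4 4 5, .rmul 4 4 5, .rmul 4 4 5, .rdiv 5 3 4,
    .rsub 5 3 5, .rjlt 5 0 25,
    -- instruction 19: if this is not below `p`, take `q` just below `p`
    .rcast 6 1, .rmul 6 6 1, .rdiv 6 0 6, .rsub 5 0 6, .rsub 7 3 6, .rdiv 5 5 7,
    -- instruction 25: `rreg 6 := α` and `rreg 0 := q`
    .rsub 6 3 0, .rsub 7 3 5, .rdiv 6 6 7, .radd 0 5 8, .add 10 1 1,
    -- instruction 30: copy an edge and toss the coin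
    .coin 11 6, .load 12 5, .store 6 12, .add 5 5 2, .add 7 6 2, .load 12 5, .store 7 12,
    .add 5 5 2, .add 9 9 11, .add 6 9 9, .jlt 5 10 30,
    .add 1 9 8]

/-- The new failure probability, where `L = ⌈log₂ n⌉`. The second value is so close to `p` that
with high probability no edge is deleted. -/
def newProb (A B L m : ℕ) (p : ℝ) : ℝ :=
  if 1 - 1 / ((A : ℝ) * L * L * L) < p then 1 - 1 / ((A : ℝ) * L * L * L)
  else (p - p / (m * (B : ℝ) ^ L)) / (1 - p / (m * (B : ℝ) ^ L))

variable {n : ℕ}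

/-- The registers and the memory in front of the counting loop, after `j` rounds, or behind it. -/
structure CountInv (B m : ℕ) (p : ℝ) (mem : ℕ → ℕ) (j : ℕ) (n : ℕ) (s : State) : Prop where
  r0 : s.reg 0 = n
  r1 : s.reg 1 = m
  r2 : s.reg 2 = 1
  r3 : s.reg 3 = j
  r4 : s.reg 4 = 2 ^ j
  r5 : s.reg 5 = 0
  r6 : s.reg 6 = 0
  r8 : s.reg 8 = 0
  r9 : s.reg 9 = 0
  rr0 : s.rreg 0 = p
  rr1 : s.rreg 1 = (B : ℝ) ^ j
  rr2 : s.rreg 2 = B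
  rr3 : s.rreg 3 = 1
  rr8 : s.rreg 8 = 0
  hmem : s.mem = mem

/-- The registers and the memory in front of the copying loop, or behind it: `acc` is
the list of the edges kept so far, and `l` the list of the edges that are still to be read. -/
structure CopyInv (m : ℕ) (q α : ℝ) (acc l : List (Fin n × Fin n)) (s : State) : Prop where
  r0 : s.reg 0 = n
  r2 : s.reg 2 = 1
  r5 : s.reg 5 = 2 * (m - l.length)
  r6 : s.reg 6 = 2 * acc.length
  r8 : s.reg 8 = 0
  r9 : s.reg 9 = acc.length
  r10 : s.reg 10 = 2 * m
  rr0 : s.rreg 0 = q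
  rr6 : s.rreg 6 = α
  hlen : acc.length + l.length ≤ m
  hacc : ∀ i (h : i < acc.length), s.mem (2 * i) = (acc[i]).1 ∧ s.mem (2 * i + 1) = (acc[i]).2
  hl : ∀ i (h : i < l.length), s.mem (2 * (m - l.length + i)) = (l[i]).1 ∧
    s.mem (2 * (m - l.length + i) + 1) = (l[i]).2

/-- The state is halted and its output is the multigraph with the edges in `l`. -/
structure HaltedWith (P : Program) (q : ℝ) (l : List (Fin n × Fin n)) (s : State) : Prop where
  pc : P.length ≤ s.pc
  r0 : s.reg 0 = n
  r1 : s.reg 1 = l.length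
  rr0 : s.rreg 0 = q
  hmem : ∀ i (h : i < l.length), s.mem (2 * i) = (l[i]).1 ∧ s.mem (2 * i + 1) = (l[i]).2

theorem run_init (A B W : ℕ) (hW : 1 < W) (hB : B < W) (G : Multigraph n) (p : ℝ) :
    ∃ s, s.pc = 6 ∧ CountInv B G.m p (initState G p).mem 0 n s ∧
      ∀ T, run (sparsify A B) W (T + 6) (initState G p) = run (sparsify A B) W T s := by
  apply Exists.intro
  refine ⟨?_, ?_, ?run⟩
  case run =>
    intro T
    simp only [run, step, sparsify, initState, Instr.exec, State.setReg, State.setRReg,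
      PMF.pure_bind, List.getElem?_cons_zero, List.getElem?_cons_succ, zero_add, Nat.reduceAdd]
    rfl
  · rfl
  · constructor <;> simp [Function.update, Nat.mod_eq_of_lt hW, Nat.mod_eq_of_lt hB, initState]

theorem run_count_round (A B W j : ℕ) {m : ℕ} {p : ℝ} {mem : ℕ → ℕ} {s : State}
    (hj : j + 1 < W) (hj2 : 2 * 2 ^ j < W) (hs : s.pc = 6) (h : CountInv B m p mem j n s) :
    ∃ s', s'.pc = (if 2 ^ (j + 1) < n then 6 else 10) ∧ CountInv B m p mem (j + 1) n s' ∧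
      ∀ T, run (sparsify A B) W (T + 4) s = run (sparsify A B) W T s' := by
  obtain ⟨pc, reg, rreg, mem'⟩ := s
  dsimp only at hs
  subst hs
  have h4 := h.r4
  have h0 := h.r0
  have h3 := h.r3
  have h2 := h.r2
  dsimp only at h4 h0 h3 h2
  have e4 : (2 ^ j + 2 ^ j) % W = 2 ^ (j + 1) := by
    rw [← two_mul, Nat.mod_eq_of_lt hj2, pow_succ, mul_comm]
  have e3 : (j + 1) % W = j + 1 := Nat.mod_eq_of_lt hj
  apply Exists.intro
  refine ⟨?_, ?_, ?run⟩
  case run =>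
    intro T
    simp only [run, step, sparsify, Instr.exec, State.setReg, State.setRReg,
      PMF.pure_bind, List.getElem?_cons_zero, List.getElem?_cons_succ, Nat.reduceAdd]
    rfl
  · simp [Function.update, h4, h0, e4]
  · obtain ⟨r0, r1, r2, r3, r4, r5, r6, r8, r9, q0, q1, q2, q3, q8, qm⟩ := h
    dsimp only at *
    constructor <;> simp [Function.update, *, pow_succ (B : ℝ)]

theorem run_count (A B W : ℕ) {m : ℕ} {p : ℝ} {mem : ℕ → ℕ} (hW : 2 * n < W)
    (d : ℕ) : ∀ (j : ℕ) {s : State}, j + d + 1 = Nat.clog 2 n → s.pc = 6 →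
      CountInv B m p mem j n s →
    ∃ s', s'.pc = 10 ∧ CountInv B m p mem (Nat.clog 2 n) n s' ∧
      ∀ T, run (sparsify A B) W (T + 4 * (d + 1)) s = run (sparsify A B) W T s' := by
  induction d with
  | zero =>
    intro j s hj hs h
    have hlt : 2 ^ j < n := by
      by_contra hcon
      have := Nat.clog_le_of_le_pow (b := 2) (not_lt.1 hcon)
      omega
    have hj' : j < 2 ^ j := Nat.lt_two_pow_self
    obtain ⟨s', h1, h2, h3⟩ := run_count_round A B W j (by omega) (by omega) hs h
    have hj1 : j + 1 = Nat.clog 2 n := by omega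
    refine ⟨s', ?_, hj1 ▸ h2, h3⟩
    rw [h1, if_neg]
    rw [not_lt, hj1]
    exact Nat.le_pow_clog (by norm_num) n
  | succ d ih =>
    intro j s hj hs h
    have hlt : 2 ^ (j + 1) < n := by
      by_contra hcon
      have := Nat.clog_le_of_le_pow (b := 2) (not_lt.1 hcon)
      omega
    have hj' : j < 2 ^ j := Nat.lt_two_pow_self
    have hpow : 2 ^ (j + 1) = 2 * 2 ^ j := by ring
    obtain ⟨s', h1, h2, h3⟩ :=
      run_count_round A B W j (by omega) (by omega) hs h
    rw [if_pos hlt] at h1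
    obtain ⟨s'', g1, g2, g3⟩ := ih (j + 1) (by omega) h1 h2
    exact ⟨s'', g1, g2, fun T => by rw [← g3, ← h3]; congr 1⟩

/-- The straight-line part takes 14 or 20 steps, depending on the branch. -/
theorem run_arith (A B W : ℕ) {L : ℕ} {p : ℝ} {s : State} (G : Multigraph n)
    (hA : A < W) (hm : 2 * G.m < W) (hs : s.pc = 10)
    (h : CountInv B G.m p (initState G p).mem L n s) :
    ∃ t ≤ 20, ∃ s', s'.pc = 30 ∧ CopyInv G.m (newProb A B L G.m p)
      ((1 - p) / (1 - newProb A B L G.m p)) [] G.edgeList s' ∧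
      ∀ T, run (sparsify A B) W (T + t) s = run (sparsify A B) W T s' := by
  obtain ⟨pc, reg, rreg, mem'⟩ := s
  dsimp only at hs
  subst hs
  obtain ⟨r0, r1, r2, r3, r4, r5, r6, r8, r9, q0, q1, q2, q3, q8, qm⟩ := h
  dsimp only at *
  have eA : A % W = A := Nat.mod_eq_of_lt hA
  have em : (G.m + G.m) % W = 2 * G.m := by rw [← two_mul, Nat.mod_eq_of_lt hm]
  have hmem : ∀ i (h : i < G.edgeList.length), mem' (2 * i) = (G.edgeList[i]).1 ∧
      mem' (2 * i + 1) = (G.edgeList[i]).2 := by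
    intro i hi
    have hi' : i < G.m := by rwa [G.length_edgeList] at hi
    have e1 : (2 * i + 1) / 2 = i := by omega
    subst qm
    simp [initState, Multigraph.edgeList, hi', e1]
  by_cases hc : 1 - 1 / ((A : ℝ) * L * L * L) < p
  · have hq : newProb A B L G.m p = 1 - 1 / ((A : ℝ) * L * L * L) := if_pos hc
    refine ⟨14, by norm_num, ?_⟩
    apply Exists.intro
    refine ⟨?_, ?_, ?run⟩
    case run =>
      intro T
      simp only [run, step, sparsify, Instr.exec, State.setReg, State.setRReg,
        PMF.pure_bind, List.getElem?_cons_zero, List.getElem?_cons_succ, Nat.reduceAdd,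
        Function.update, eq_rec_constant, dite_eq_ite, Nat.reduceEqDiff, if_true, if_false,
        eA, r3, q3, q0, hc, OfNat.zero_ne_ofNat]
      rfl
    · rfl
    rw [hq]
    constructor <;> simp [Function.update, *, G.length_edgeList]
    intro i hi
    subst qm
    exact hmem i (by rwa [G.length_edgeList])
  · have hq : newProb A B L G.m p =
        (p - p / (G.m * (B : ℝ) ^ L)) / (1 - p / (G.m * (B : ℝ) ^ L)) := if_neg hc
    refine ⟨20, le_rfl, ?_⟩
    apply Exists.intro
    refine ⟨?_, ?_, ?run⟩
    case run =>
      intro T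
      simp only [run, step, sparsify, Instr.exec, State.setReg, State.setRReg,
        PMF.pure_bind, List.getElem?_cons_zero, List.getElem?_cons_succ, Nat.reduceAdd,
        Function.update, eq_rec_constant, dite_eq_ite, Nat.reduceEqDiff, if_true, if_false,
        eA, r3, q3, q0, hc, OfNat.zero_ne_ofNat]
      rfl
    · rfl
    rw [hq]
    constructor <;> simp [Function.update, *, G.length_edgeList]
    intro i hi
    subst qm
    exact hmem i (by rwa [G.length_edgeList])

/-- The copy is made in any case; the coin decides whether it is part of the list `acc` from now
on. The write position never overtakes the read position, so that no unread edge is overwritten. -/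
theorem run_copy_round (A B W : ℕ) {m : ℕ} {q α : ℝ} {acc l : List (Fin n × Fin n)}
    {e : Fin n × Fin n} {s : State} (hn : n < W) (hm : 2 * m < W) (hs : s.pc = 30)
    (h : CopyInv m q α acc (e :: l) s) :
    ∃ s' : Bool → State, (∀ b, (s' b).pc = if l = [] then 41 else 30) ∧
      (∀ b, CopyInv m q α (acc ++ if b then [e] else []) l (s' b)) ∧
      ∀ T, run (sparsify A B) W (T + 11) s =
        (flip α).bind fun b => run (sparsify A B) W T (s' b) := by
  obtain ⟨pc, reg, rreg, mem⟩ := s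
  dsimp only at hs
  subst hs
  obtain ⟨r0, r2, r5, r6, r8, r9, r10, q0, q6, hlen, hacc, hl⟩ := h
  dsimp only at *
  rw [List.length_cons] at hlen
  obtain ⟨i, hi⟩ : ∃ i, m = i + (l.length + 1) := ⟨m - (l.length + 1), by omega⟩
  have hi1 : m - (l.length + 1) = i := by omega
  have hi2 : m - l.length = i + 1 := by omega
  rw [List.length_cons, hi1] at r5
  obtain ⟨g1, g2⟩ := hl 0 (by simp)
  simp only [List.length_cons, hi1, add_zero, List.getElem_cons_zero] at g1 g2
  have hji : acc.length ≤ i := by omega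
  have m1 : 1 % W = 1 := Nat.mod_eq_of_lt (by omega)
  have m2 : (2 * i + 1) % W = 2 * i + 1 := Nat.mod_eq_of_lt (by omega)
  have m3 : (2 * i + 1 + 1) % W = 2 * i + 1 + 1 := Nat.mod_eq_of_lt (by omega)
  have m4 : (2 * acc.length + 1) % W = 2 * acc.length + 1 := Nat.mod_eq_of_lt (by omega)
  have m5 : (acc.length + 1) % W = acc.length + 1 := Nat.mod_eq_of_lt (by omega)
  have m6 : acc.length % W = acc.length := Nat.mod_eq_of_lt (by omega)
  have m7 : (acc.length + acc.length) % W = 2 * acc.length := by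
    rw [← two_mul]; exact Nat.mod_eq_of_lt (by omega)
  have m8 : (acc.length + 1 + (acc.length + 1)) % W = 2 * (acc.length + 1) := by
    rw [← two_mul]; exact Nat.mod_eq_of_lt (by omega)
  have m9 : (e.1 : ℕ) % W = e.1 := Nat.mod_eq_of_lt (e.1.2.trans hn)
  have m10 : (e.2 : ℕ) % W = e.2 := Nat.mod_eq_of_lt (e.2.2.trans hn)
  have n1 : 2 * i + 1 ≠ 2 * acc.length := by omega
  have hpc : (if 2 * i + 1 + 1 < 2 * m then 30 else 41) = if l = [] then 41 else 30 := by
    rcases l with _ | ⟨e', l⟩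
    · rw [if_neg (by simp at hi; omega), if_pos rfl]
    · rw [if_pos (by simp at hi; omega), if_neg (by simp)]
  have hlen' : acc.length + 1 + l.length ≤ m := by omega
  have hl' : ∀ k (hk : k < l.length), mem (2 * (i + 1 + k)) = l[k].1 ∧
      mem (2 * (i + 1 + k) + 1) = l[k].2 := by
    intro k hk
    have := hl (k + 1) (by simpa using hk)
    simpa only [List.length_cons, hi1, List.getElem_cons_succ,
      show i + (k + 1) = i + 1 + k by omega] using this
  clear hi hl
  apply Exists.intro
  refine ⟨?_, ?_, ?run⟩
  case run =>
    intro T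
    simp only [run, step, sparsify, Instr.exec, State.setReg, State.setRReg, PMF.bind_map,
      PMF.pure_bind, List.getElem?_cons_zero, List.getElem?_cons_succ, Nat.reduceAdd, q6,
      Function.comp_def]
    rfl
  · intro b
    cases b <;> simp [Function.update, r2, r5, r10, m2, m3, hpc]
  · have hcopy : ∀ k (hk : k < l.length), i + 1 + k ≠ acc.length ∧
        2 * (i + 1 + k) ≠ 2 * acc.length + 1 ∧ 2 * (i + 1 + k) + 1 ≠ 2 * acc.length := by
      omega
    have hpar : ∀ k, 2 * k ≠ 2 * acc.length + 1 ∧ 2 * k + 1 ≠ 2 * acc.length := by omega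
    intro b
    cases b
    · constructor <;>
        simp [Function.update_apply, r0, r2, r5, r6, r8, r9, r10, q0, q6, m2, m3, m4, m6, m7, m9,
          m10, n1, g1, g2, hi2]
      · omega
      · omega
      · intro k hk
        simp [hk.ne, hpar, hacc k hk]
      · intro k hk
        simp [hcopy k hk, hl' k hk]
    · constructor <;>
        simp [Function.update_apply, r0, r2, r5, r6, r8, r9, r10, q0, q6, m1, m2, m3, m4, m5, m8, m9,
          m10, n1, g1, g2, hi2]
      · omega
      · omega
      · intro k hk
        rcases hk.lt_or_eq with hk | rfl
        · simp [hk.ne, hpar, hacc k hk, List.getElem_append_left hk]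
        · simp
      · intro k hk
        simp [hcopy k hk, hl' k hk]

namespace Multigraph

/-- The multigraph on `n` vertices that is stored in the machine. Numbers that are not vertices
are reduced modulo `n`. -/
def ofState (hn : 0 < n) (s : State) : Multigraph n where
  m := s.reg 1
  ends e := (⟨s.mem (2 * e) % n, Nat.mod_lt _ hn⟩, ⟨s.mem (2 * e + 1) % n, Nat.mod_lt _ hn⟩)

end Multigraph

theorem HaltedWith.ofState_eq {P : Program} {q : ℝ} {l : List (Fin n × Fin n)} {s : State}
    (h : HaltedWith P q l s) (hn : 0 < n) : Multigraph.ofState hn s = Multigraph.ofList l := by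
  obtain ⟨-, -, h1, -, h2⟩ := h
  obtain ⟨pc, reg, rreg, mem⟩ := s
  dsimp only at h1 h2
  simp only [Multigraph.ofState, Multigraph.ofList]
  have key : ∀ k, k = l.length → (⟨k, fun e : Fin k => (⟨mem (2 * e) % n, Nat.mod_lt _ hn⟩,
      ⟨mem (2 * e + 1) % n, Nat.mod_lt _ hn⟩)⟩ : Multigraph n) = ⟨l.length, l.get⟩ := by
    rintro k rfl
    congr 1
    funext e
    obtain ⟨g1, g2⟩ := h2 e e.2
    ext
    · simp [g1, Nat.mod_eq_of_lt]
    · simp [g2, Nat.mod_eq_of_lt]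
  exact key _ h1

theorem HaltedWith.outputs {P : Program} {q : ℝ} {l : List (Fin n × Fin n)} {s : State}
    (h : HaltedWith P q l s) : Outputs P s (Multigraph.ofList l) q :=
  ⟨h.pc, h.r0, h.r1, h.rr0, fun e => h.hmem e e.2⟩

theorem run_exit (A B W : ℕ) {m : ℕ} {q α : ℝ} {acc : List (Fin n × Fin n)} {s : State}
    (hm : m < W) (hs : s.pc = 41) (h : CopyInv m q α acc [] s) :
    ∃ s', HaltedWith (sparsify A B) q acc s' ∧ run (sparsify A B) W 1 s = PMF.pure s' := by
  obtain ⟨pc, reg, rreg, mem⟩ := s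
  dsimp only at hs
  subst hs
  obtain ⟨r0, r2, r5, r6, r8, r9, r10, q0, q6, hlen, hacc, hl⟩ := h
  dsimp only at *
  have m1 : acc.length % W = acc.length := Nat.mod_eq_of_lt (by simp at hlen; omega)
  apply Exists.intro
  refine ⟨?_, ?run⟩
  case run =>
    simp only [run, step, sparsify, Instr.exec, State.setReg, PMF.pure_bind,
      List.getElem?_cons_zero, List.getElem?_cons_succ]
    rfl
  constructor
  · simp [sparsify]
  · simp [Function.update, r0]
  · simp [Function.update, r8, r9, m1]
  · exact q0
  · exact hacc

/-- The copying loop samples the random sublist of the edges that are still to be read. -/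
theorem run_copy (A B W : ℕ) {m : ℕ} {q α : ℝ} (hn0 : 0 < n) (hn : n < W) (hm : 2 * m < W)
    (l : List (Fin n × Fin n)) : ∀ (acc : List (Fin n × Fin n)) (s : State),
      s.pc = (if l = [] then 41 else 30) → CopyInv m q α acc l s →
    (∀ s' ∈ (run (sparsify A B) W (11 * l.length + 1) s).support,
      ∃ l' : List (Fin n × Fin n), HaltedWith (sparsify A B) q l' s') ∧
    (run (sparsify A B) W (11 * l.length + 1) s).map (Multigraph.ofState hn0) =
      (keepLaw α l).map fun l' => Multigraph.ofList (acc ++ l') := by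
  induction l with
  | nil =>
    intro acc s hs h
    obtain ⟨s', h1, h2⟩ := run_exit A B W (by omega) (by simpa using hs) h
    rw [List.length_nil, mul_zero, zero_add, h2, PMF.pure_map, keepLaw, PMF.pure_map,
      h1.ofState_eq, List.append_nil]
    refine ⟨fun s'' hs'' => ?_, rfl⟩
    rw [PMF.support_pure, Set.mem_singleton_iff] at hs''
    exact ⟨acc, hs'' ▸ h1⟩
  | cons e l ih =>
    intro acc s hs h
    obtain ⟨s', h1, h2, h3⟩ := run_copy_round A B W hn hm (by simpa using hs) h
    rw [List.length_cons, show 11 * (l.length + 1) + 1 = 11 * l.length + 1 + 11 by ring, h3]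
    refine ⟨fun s'' hs'' => ?_, ?_⟩
    · obtain ⟨b, -, hb⟩ := (PMF.mem_support_bind_iff _ _ _).1 hs''
      exact (ih _ _ (h1 b) (h2 b)).1 _ hb
    · rw [PMF.map_bind, keepLaw, PMF.map_bind]
      congr 1
      funext b
      rw [(ih _ _ (h1 b) (h2 b)).2, PMF.map_comp]
      congr 1
      funext l'
      cases b <;> simp

/-- The law of the output, and the running time. -/
theorem computes_sparsify (A B κ : ℕ) (hκ : 2 ≤ κ) (hA : A < 2 ^ κ) (hB : B < 2 ^ κ) (hn : 2 ≤ n)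
    (G : Multigraph n) (hm : 1 ≤ G.m) (p : ℝ) :
    ∃ T ≤ 4 * Nat.clog 2 n + 11 * G.m + 27,
      Computes (sparsify A B) κ T G p
        ((keepLaw ((1 - p) / (1 - newProb A B (Nat.clog 2 n) G.m p)) G.edgeList).map
          Multigraph.ofList) (newProb A B (Nat.clog 2 n) G.m p) := by
  set W := (n + G.m + 2) ^ κ with hW
  have hW2 : 2 ^ κ ≤ W := Nat.pow_le_pow_left (by omega) κ
  have hWsq : (n + G.m + 2) * (n + G.m + 2) ≤ W := by
    rw [← sq]; exact Nat.pow_le_pow_right (by omega) hκ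
  have hWn : 2 * n < W := by nlinarith
  have hWm : 2 * G.m < W := by nlinarith
  have hclog : 0 < Nat.clog 2 n := Nat.clog_pos (by norm_num) hn
  obtain ⟨d, hd⟩ : ∃ d, Nat.clog 2 n = d + 1 := ⟨Nat.clog 2 n - 1, by omega⟩
  obtain ⟨s1, p1, i1, e1⟩ := run_init A B W (by omega) (by omega) G p
  obtain ⟨s2, p2, i2, e2⟩ := run_count A B W hWn d 0 (by omega) p1 i1
  obtain ⟨t, ht, s3, p3, i3, e3⟩ := run_arith A B W G (by omega) hWm p2 i2
  have hne : G.edgeList ≠ [] := by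
    intro h
    have := G.length_edgeList
    rw [h, List.length_nil] at this
    omega
  obtain ⟨h1, h2⟩ := run_copy A B W (by omega) (by omega) hWm G.edgeList [] s3
    (by rw [if_neg hne]; exact p3) i3
  rw [G.length_edgeList] at h1 h2
  have hrun : run (sparsify A B) W (11 * G.m + 1 + t + 4 * (d + 1) + 6) (initState G p) =
      run (sparsify A B) W (11 * G.m + 1) s3 := by rw [e1, e2, e3]
  refine ⟨11 * G.m + 1 + t + 4 * (d + 1) + 6, by omega, Multigraph.ofState (by omega), ?_, ?_⟩
  · intro s hs
    rw [hrun] at hs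
    obtain ⟨l', hl'⟩ := h1 s hs
    rw [hl'.ofState_eq]
    exact hl'.outputs
  · rw [hrun, h2]
    rfl

/-! ### The minimum cut in the recursive case -/

section

variable {n : ℕ}

theorem one_lt_log {n : ℕ} (hn : 3 ≤ n) : 1 < Real.log n := by
  rw [Real.lt_log_iff_exp_lt (by positivity)]
  exact Real.exp_one_lt_three.trans_le (by exact_mod_cast hn)

theorem log_two_mul_le {n : ℕ} (hn : 2 ≤ n) : Real.log (2 * n) ≤ 2 * Real.log n := by
  have h : (2 : ℝ) ≤ n := by exact_mod_cast hn
  rw [Real.log_mul (by norm_num) (by positivity), two_mul]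
  exact add_le_add_left (Real.log_le_log (by norm_num) h) _

theorem Multigraph.minCut_le_cutSize (G : Multigraph n) (S : Finset (Fin n)) (h1 : S.Nonempty)
    (h2 : S ≠ Finset.univ) :
    G.minCut ≤ cutSize (fun e => (G.ends e).1) (fun e => (G.ends e).2) S :=
  G.minCut_le (mem_properSets.2 ⟨h1, h2⟩)

theorem Multigraph.sum_exp_card_boundary_le (G : Multigraph n) (hn : 1 ≤ n) {τ B : ℝ}
    (hc : 1 ≤ G.minCut) (hB : 0 ≤ B) (hτ0 : 0 ≤ τ)
    (hτ : 2 * (B + 2) * Real.log (2 * n) ≤ G.minCut * τ) :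
    ∑ S ∈ properSets n, Real.exp (-τ * (G.boundary S).card) ≤ 2 * (2 * n : ℝ) ^ (-B) := by
  have : Nonempty (Fin n) := ⟨⟨0, hn⟩⟩
  have := sum_exp_cutSize_le (fun e => (G.ends e).1) (fun e => (G.ends e).2) (c := G.minCut)
    (τ := τ) hc hB hτ0 (by rwa [Fintype.card_fin]) G.minCut_le_cutSize
  rwa [Fintype.card_fin] at this

/-- When all cuts are large, disconnection is very unlikely. -/
theorem Multigraph.minCut_mul_neg_log_le (G : Multigraph n) (hn : 3 ≤ n) {p D : ℝ} (h0 : 0 < p)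
    (h1 : p < 1) (hD : 0 ≤ D) (hu : (n : ℝ) ^ (-D) ≤ G.unreliability p) :
    G.minCut * -Real.log p ≤ 4 * (D + 3) * Real.log n := by
  have hlog := one_lt_log hn
  have hn0 : (0 : ℝ) < n := by positivity
  rcases Nat.eq_zero_or_pos G.minCut with hc | hc
  · rw [hc, Nat.cast_zero, zero_mul]; positivity
  have hlogp : 0 < -Real.log p := neg_pos.2 (Real.log_neg h0 h1)
  by_contra hcon
  rw [not_le] at hcon
  have h2 := log_two_mul_le (n := n) (by omega)
  have hsum := G.sum_exp_card_boundary_le (by omega) (τ := -Real.log p) (B := D + 1) hc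
    (by linarith) hlogp.le (by nlinarith)
  have hle := G.unreliability_le_sum (by omega) h0.le h1.le
  have heq : ∀ S, Real.exp (- -Real.log p * (G.boundary S).card) = p ^ (G.boundary S).card := by
    intro S
    rw [neg_neg, mul_comm, Real.exp_nat_mul, Real.exp_log h0]
  simp only [heq] at hsum
  have h3 : 2 * (2 * n : ℝ) ^ (-(D + 1)) < (n : ℝ) ^ (-D) := by
    rw [neg_add, Real.rpow_add (by positivity), Real.rpow_neg_one]
    have h4 : (2 * n : ℝ) ^ (-D) ≤ (n : ℝ) ^ (-D) :=
      Real.rpow_le_rpow_of_nonpos hn0 (by linarith) (by linarith)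
    have h5 : 0 < (n : ℝ) ^ (-D) := by positivity
    have h6 : 2 * (2 * n : ℝ)⁻¹ < 1 := by
      rw [mul_inv, ← mul_assoc, mul_inv_cancel₀ (by norm_num), one_mul]
      exact inv_lt_one_of_one_lt₀ (by exact_mod_cast (by omega : 1 < n))
    have h7 : (0 : ℝ) < 2 * (2 * n : ℝ)⁻¹ := by positivity
    nlinarith
  linarith

/-- Below the threshold a minimum cut is unlikely to fail, and in particular there is one. -/
theorem Multigraph.le_minCut_mul_neg_log (G : Multigraph n) (hn : 3 ≤ n) {p c : ℝ} (hc : 0 < c)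
    (h0 : 0 < p) (hp : p < G.threshold c) : c ≤ G.minCut * -Real.log p := by
  have hne : {t : ℝ | 0 ≤ t ∧ t ≤ 1 ∧
      G.unreliability t ≤ (n : ℝ) ^ (-c / Real.log (Real.log n)) ∧
      ∀ p : ℝ, 0 < p → p < t → G.expFailedPairs p ≤ G.expFailedCuts p / Real.log n}.Nonempty := by
    by_contra hcon
    rw [Set.not_nonempty_iff_eq_empty] at hcon
    rw [threshold, hcon, Real.sSup_empty] at hp
    linarith
  obtain ⟨t, ⟨ht0, ht1, htu, -⟩, hpt⟩ := exists_lt_of_lt_csSup hne hp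
  obtain ⟨S, hS, hScard⟩ := G.exists_card_boundary_eq_minCut (by omega)
  have h1 := G.pow_card_boundary_le_unreliability ht0 ht1 hS
  rw [hScard] at h1
  have h2 : p ^ G.minCut ≤ t ^ G.minCut := pow_le_pow_left₀ h0.le hpt.le _
  have hlog := one_lt_log hn
  have hll : 0 < Real.log (Real.log n) := Real.log_pos hlog
  have hll2 : Real.log (Real.log n) ≤ Real.log n := by
    have := Real.log_le_sub_one_of_pos (by linarith : 0 < Real.log n)
    linarith
  have h3 := Real.log_le_log (by positivity) ((h2.trans h1).trans htu)
  rw [Real.log_pow, Real.log_rpow (by positivity)] at h3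
  have h4 : c ≤ c / Real.log (Real.log n) * Real.log n := by
    rw [div_mul_eq_mul_div, le_div_iff₀ hll]
    nlinarith
  rw [neg_div, neg_mul] at h3
  linarith

/-- In the recursive case the unreliability is at least a fixed power of `1 / n`. The iterated
logarithm is smallest at `n = 3`, where it is positive. -/
theorem rpow_neg_le_of_recursiveCase (G : Multigraph n) (hn : 3 ≤ n) {C c p : ℝ}
    (h : G.RecursiveCase C c p) :
    (n : ℝ) ^ (-(1 + |C| / Real.log (Real.log 3))) ≤ G.unreliability p := by
  refine le_trans (Real.rpow_le_rpow_of_exponent_le (by exact_mod_cast (by omega : 1 ≤ n)) ?_) h.1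
  have h3 : 1 < Real.log 3 := by exact_mod_cast one_lt_log (n := 3) le_rfl
  have hll : 0 < Real.log (Real.log 3) := Real.log_pos h3
  have hle : Real.log (Real.log 3) ≤ Real.log (Real.log n) := by
    refine Real.log_le_log (by linarith) (Real.log_le_log (by norm_num) (by exact_mod_cast hn))
  have h5 : C / Real.log (Real.log n) ≤ |C| / Real.log (Real.log 3) :=
    div_le_div₀ (abs_nonneg C) (le_abs_self C) hll hle
  linarith

/-! ### Sampling preserves the cuts -/

theorem Multigraph.PreservesCuts.mono {G H : Multigraph n} {α δ δ' : ℝ} (hα : 0 ≤ α)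
    (h : H.PreservesCuts G α δ) (hδ : δ ≤ δ') : H.PreservesCuts G α δ' := by
  intro S
  obtain ⟨h1, h2⟩ := h S
  have h3 : 0 ≤ α * (G.boundary S).card := by positivity
  constructor <;> nlinarith

theorem Multigraph.PreservesCuts.minCut_le {G H : Multigraph n} {α δ : ℝ} (hn : 2 ≤ n)
    (h : H.PreservesCuts G α δ) : (H.minCut : ℝ) ≤ (1 + δ) * α * G.minCut := by
  obtain ⟨S, hS, hScard⟩ := G.exists_card_boundary_eq_minCut hn
  rw [← hScard]
  exact le_trans (by exact_mod_cast H.minCut_le hS) (h S).2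

open Classical in
/-- Karger's sparsification theorem: the union bound over the cuts, with Chernoff's bound for
each. -/
theorem Multigraph.keepAvg_not_preservesCuts_le (G : Multigraph n) (hn : 1 ≤ n) {α δ B : ℝ}
    (hα0 : 0 ≤ α) (hα1 : α ≤ 1) (hδ0 : 0 ≤ δ) (hδ1 : δ ≤ 1) (hc : 1 ≤ G.minCut) (hB : 0 ≤ B)
    (hτ : 2 * (B + 2) * Real.log (2 * n) ≤ G.minCut * (α * δ ^ 2 / 4)) :
    keepAvg α G.edgeList (fun l' => if (ofList l').PreservesCuts G α δ then 0 else 1) ≤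
      4 * (2 * n : ℝ) ^ (-B) := by
  have h1 := G.sum_exp_card_boundary_le hn hc hB (by positivity) hτ
  have h2 : keepAvg α G.edgeList
      (fun l' => if (ofList l').PreservesCuts G α δ then 0 else 1) ≤
      ∑ S ∈ properSets n, keepAvg α G.edgeList (fun l' =>
        if (1 - δ) * α * G.edgeList.countP (crosses S) ≤ l'.countP (crosses S) ∧
          (l'.countP (crosses S) : ℝ) ≤ (1 + δ) * α * G.edgeList.countP (crosses S)
          then 0 else 1) := by
    rw [← keepAvg_sum]
    refine keepAvg_mono hα0 hα1 _ fun l' => ?_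
    have hnn : ∀ S ∈ properSets n, (0 : ℝ) ≤
        if (1 - δ) * α * G.edgeList.countP (crosses S) ≤ l'.countP (crosses S) ∧
          (l'.countP (crosses S) : ℝ) ≤ (1 + δ) * α * G.edgeList.countP (crosses S)
          then 0 else 1 := by
      intro S _; split_ifs <;> norm_num
    split_ifs with h
    · exact Finset.sum_nonneg hnn
    · simp only [PreservesCuts, card_boundary, edgeList_ofList] at h
      push Not at h
      obtain ⟨S, hS⟩ := h
      have hSp : S ∈ properSets n := by
        -- an empty or full vertex set has an empty boundary
        by_contra hcon
        have h0 : ∀ l : List (Fin n × Fin n), l.countP (crosses S) = 0 := by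
          intro l
          rw [List.countP_eq_zero]
          intro e _
          rw [mem_properSets, not_and_or, not_not, Finset.not_nonempty_iff_eq_empty] at hcon
          rcases hcon with rfl | rfl <;> simp [crosses]
        rw [h0, h0] at hS
        simp at hS
      refine le_trans ?_ (Finset.single_le_sum hnn hSp)
      rw [if_neg]
      rintro ⟨h3, h4⟩
      exact absurd h4 (not_le.2 (hS h3))
  refine h2.trans ?_
  calc _ ≤ ∑ S ∈ properSets n, 2 * Real.exp (-(α * δ ^ 2 / 4) * (G.boundary S).card) := by
        refine Finset.sum_le_sum fun S _ => ?_
        rw [card_boundary]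
        exact keepAvg_countP_deviation_le hα0 hα1 hδ0 hδ1 _ _
    _ ≤ 4 * (2 * n : ℝ) ^ (-B) := by
        rw [← Finset.mul_sum]; linarith

end

/-! ### The two cases -/

section

variable {n : ℕ}

/-- The law of the output of the program. -/
def Multigraph.sampleLaw (G : Multigraph n) (α : ℝ) : PMF (Multigraph n) :=
  (keepLaw α G.edgeList).map Multigraph.ofList

theorem Multigraph.expect_sampleLaw (G : Multigraph n) {α : ℝ} (h0 : 0 ≤ α) (h1 : α ≤ 1)
    (X : Multigraph n → ℝ) :
    expect (G.sampleLaw α) X = keepAvg α G.edgeList (fun l' => X (ofList l')) :=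
  expect_map_keepLaw h0 h1 _ _ _

theorem Multigraph.isSubgraph_of_mem_support_sampleLaw {G H : Multigraph n} {α : ℝ}
    (h : H ∈ (G.sampleLaw α).support) : H.IsSubgraph G := by
  obtain ⟨l', hl', rfl⟩ := (PMF.mem_support_map_iff _ _ _).1 h
  exact isSubgraph_ofList (sublist_of_mem_support_keepLaw hl')

/-- `u_H(q)` is an unbiased estimator. -/
theorem Multigraph.expect_unreliability (G : Multigraph n) {α q : ℝ} (h0 : 0 ≤ α) (h1 : α ≤ 1) :
    expect (G.sampleLaw α) (fun H => H.unreliability q) =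
      G.unreliability (1 - α * (1 - q)) := by
  rw [G.expect_sampleLaw h0 h1, G.unreliability_eq, ← keepAvg_failAvg]
  simp only [unreliability_eq, edgeList_ofList]

/-- Hypercontractivity for the indicator of disconnection, whose powers are itself. -/
theorem Multigraph.relSecondMoment_le (G : Multigraph n) {α q : ℝ} (h0 : 0 ≤ α) (h1 : α ≤ 1)
    (hq0 : 0 ≤ q) (hq1 : q ≤ 1) (hu : 0 < G.unreliability (1 - α * (1 - q))) :
    relSecondMoment (G.sampleLaw α) (fun H => H.unreliability q) ≤
      G.unreliability (1 - α * (1 - q)) ^ (-(2 * (1 - q) / (2 - q))) := by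
  have hs : 0 < 2 - q := by linarith
  rw [relSecondMoment, G.expect_unreliability h0 h1, G.expect_sampleLaw h0 h1,
    div_le_iff₀ (by positivity), ← Real.rpow_natCast, ← Real.rpow_add hu]
  simp only [unreliability_eq, edgeList_ofList]
  refine (keepAvg_failAvg_sq_le hq0 hq1 h0 h1 disconnected_nonneg disconnected_antitone _ _).trans
    (le_of_eq ?_)
  simp only [disconnected_rpow _ hs]
  congr 1
  push_cast
  field_simp
  ring

theorem Multigraph.prob_sampleLaw_ge (G : Multigraph n) {α β : ℝ} (h0 : 0 ≤ α) (h1 : α ≤ 1)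
    {Good : Multigraph n → Prop} [DecidablePred Good] (A : Set (Multigraph n))
    (hA : ∀ H, Good H → H ∈ A)
    (h : keepAvg α G.edgeList (fun l' => if Good (ofList l') then 0 else 1) ≤ β) :
    1 - β ≤ prob (G.sampleLaw α) A := by
  classical
  rw [prob_eq_expect, G.expect_sampleLaw h0 h1]
  have h2 : keepAvg α G.edgeList (fun l' => 1 + -1 * if Good (ofList l') then 0 else 1) ≤
      keepAvg α G.edgeList (fun l' => if ofList l' ∈ A then 1 else 0) := by
    refine keepAvg_mono h0 h1 _ fun l' => ?_
    by_cases hg : Good (ofList l')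
    · simp [hg, hA _ hg]
    · simp only [hg, if_false]
      split_ifs <;> norm_num
  rw [keepAvg_add, keepAvg_const, keepAvg_const_mul] at h2
  linarith

/-- When deletions are rare, the second moment is trivially small. -/
theorem Multigraph.relSecondMoment_le_two (G : Multigraph n) {α q : ℝ} (h0 : 0 ≤ α) (h1 : α ≤ 1)
    (hq0 : 0 ≤ q) (hq1 : q ≤ 1) (hu0 : 0 < G.unreliability (1 - α * (1 - q)))
    (hu1 : G.unreliability (1 - α * (1 - q)) ≤ 1)
    (hα : 1 - G.unreliability (1 - α * (1 - q)) ^ 2 / 4 ≤ α ^ G.m) :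
    relSecondMoment (G.sampleLaw α) (fun H => H.unreliability q) ≤ 2 := by
  have hmean := G.expect_unreliability (q := q) h0 h1
  rw [relSecondMoment, hmean, G.expect_sampleLaw h0 h1, div_le_iff₀ (by positivity)]
  rw [G.expect_sampleLaw h0 h1] at hmean
  set u := G.unreliability (1 - α * (1 - q))
  set x := (ofList G.edgeList).unreliability q
  have hX : ∀ l', 0 ≤ (ofList l' : Multigraph n).unreliability q := fun l' =>
    unreliability_nonneg _ hq0 hq1
  have hX1 : ∀ l', (ofList l' : Multigraph n).unreliability q ≤ 1 := fun l' =>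
    unreliability_le_one _ hq0 hq1
  have h2 := pow_length_mul_le_keepAvg h0 h1 G.edgeList hX
  have h3 := pow_length_mul_le_keepAvg h0 h1 G.edgeList
    (X := fun l' => 1 + -1 * (ofList l' : Multigraph n).unreliability q ^ 2) fun l' => by
      have := pow_le_one₀ (hX l') (hX1 l') (n := 2); linarith
  rw [keepAvg_add, keepAvg_const, keepAvg_const_mul, G.length_edgeList] at h3
  rw [hmean, G.length_edgeList] at h2
  change α ^ G.m * x ≤ u at h2
  change α ^ G.m * (1 + -1 * x ^ 2) ≤ _ at h3
  have hx0 : 0 ≤ x := hX _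
  have h4 : 3 / 4 ≤ α ^ G.m := by nlinarith
  have h5 : x ≤ 4 / 3 * u := by nlinarith
  have h6 : α ^ G.m * x ^ 2 ≤ 4 / 3 * u ^ 2 := by
    have := mul_le_mul h2 h5 hx0 hu0.le
    nlinarith
  nlinarith

end

theorem log_le_clog {n : ℕ} (hn : 3 ≤ n) : Real.log n ≤ Nat.clog 2 n := by
  have h1 : (n : ℝ) ≤ 2 ^ Nat.clog 2 n := by exact_mod_cast Nat.le_pow_clog (by norm_num) n
  have h2 := Real.log_le_log (by positivity) h1
  rw [Real.log_pow] at h2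
  have h3 : Real.log 2 ≤ 1 := by linarith [Real.log_two_lt_d9]
  nlinarith [Nat.cast_nonneg (α := ℝ) (Nat.clog 2 n)]

theorem clog_le_three_mul_log {n : ℕ} (hn : 3 ≤ n) : (Nat.clog 2 n : ℝ) ≤ 3 * Real.log n := by
  have hlog := one_lt_log hn
  have h0 : 0 < Nat.clog 2 n := Nat.clog_pos (by norm_num) (by omega)
  obtain ⟨d, hd⟩ : ∃ d, Nat.clog 2 n = d + 1 := ⟨Nat.clog 2 n - 1, by omega⟩
  have h1 := Nat.pow_pred_clog_lt_self (b := 2) (by norm_num) (x := n) (by omega)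
  rw [hd, Nat.pred_succ] at h1
  have h2 : (2 : ℝ) ^ d ≤ n := by exact_mod_cast h1.le
  have h3 := Real.log_le_log (by positivity) h2
  rw [Real.log_pow] at h3
  rw [hd]
  push_cast
  have h4 := Real.log_two_gt_d9
  nlinarith [Nat.cast_nonneg (α := ℝ) d]

theorem four_mul_rpow_neg_le {n : ℕ} (hn : 1 ≤ n) (b : ℝ) :
    4 * (2 * n : ℝ) ^ (-(|b| + 2)) ≤ (n : ℝ) ^ (-b) := by
  have hn1 : (1 : ℝ) ≤ n := by exact_mod_cast hn
  have hn0 : (0 : ℝ) < n := by linarith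
  calc 4 * (2 * n : ℝ) ^ (-(|b| + 2))
      = 4 * ((2 * n : ℝ) ^ 2)⁻¹ * (2 * n : ℝ) ^ (-|b|) := by
        rw [neg_add, Real.rpow_add (by positivity), Real.rpow_neg (by positivity) 2,
          Real.rpow_two]; ring
    _ ≤ 1 * (n : ℝ) ^ (-|b|) := by
        refine mul_le_mul ?_ (Real.rpow_le_rpow_of_nonpos hn0 (by linarith)
          (neg_nonpos.2 (abs_nonneg b))) (by positivity) zero_le_one
        rw [← div_eq_mul_inv, div_le_one (by positivity)]
        nlinarith
    _ ≤ (n : ℝ) ^ (-b) := by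
        rw [one_mul]
        exact Real.rpow_le_rpow_of_exponent_le hn1 (neg_le_neg (le_abs_self b))

/-- The second moment bound with `1 - q = 1 / R`, for an unreliability that is at least a power of
`1 / n`. -/
theorem rpow_neg_le_two {n : ℕ} (hn : 3 ≤ n) {u D R : ℝ} (hD : 0 ≤ D)
    (hu : (n : ℝ) ^ (-D) ≤ u) (hR : 0 < R) (hDR : 4 * D * Real.log n ≤ R) :
    u ^ (-(2 * (1 - (1 - 1 / R)) / (2 - (1 - 1 / R)))) ≤ 2 := by
  have hlog := one_lt_log hn
  have hn0 : (0 : ℝ) < n := by positivity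
  have hRpos : 0 < 1 / R := by positivity
  rw [sub_sub_cancel]
  set η := 2 * (1 / R) / (2 - (1 - 1 / R)) with hη
  have hη0 : 0 ≤ η := by
    rw [hη]; exact div_nonneg (by linarith) (by linarith)
  have hη2 : η ≤ 2 * (1 / R) := by
    rw [hη]; exact div_le_self (by linarith) (by linarith)
  have h3 : D * η * Real.log n ≤ 1 / 2 := by
    calc D * η * Real.log n ≤ D * (2 * (1 / R)) * Real.log n := by gcongr
      _ = 4 * D * Real.log n / (2 * R) := by field_simp; ring
      _ ≤ R / (2 * R) := by gcongr
      _ = 1 / 2 := by field_simp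
  calc u ^ (-η) ≤ ((n : ℝ) ^ (-D)) ^ (-η) :=
        Real.rpow_le_rpow_of_nonpos (by positivity) hu (by linarith)
    _ = Real.exp (D * η * Real.log n) := by
        rw [← Real.rpow_mul hn0.le, Real.rpow_def_of_pos hn0]
        congr 1; ring
    _ ≤ Real.exp (Real.log 2) := by
        apply Real.exp_le_exp.2
        linarith [Real.log_two_gt_d9]
    _ = 2 := Real.exp_log (by norm_num)

/-- What is to be shown of the output law `G.sampleLaw α` and the new failure probability `q`. The
factor `β` by which the cuts shrink need not be the keeping probability `α`, and `M` bounds the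
minimum cut. -/
structure GoodSample {n : ℕ} (G : Multigraph n) (p b K M β q α : ℝ) : Prop where
  hβ0 : 0 < β
  hβ1 : β ≤ 1
  hα0 : 0 ≤ α
  hα1 : α ≤ 1
  hprob : 1 - (n : ℝ) ^ (-b) ≤ prob (G.sampleLaw α)
    {H | (H.minCut : ℝ) ≤ M ∧ H.PreservesCuts G β (K / Real.log n)}
  hq0 : 0 < q
  hqp : q < p
  hmean : 1 - α * (1 - q) = p
  hmoment : relSecondMoment (G.sampleLaw α) (fun H => H.unreliability q) ≤ 2

/-- The case in which the edges are thinned out. Here `α λ` is at least a large multiple of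
`(log n) ^ 3`, so that all cuts are preserved, and `1 - q` is so small that the exponent in the
second moment bound is harmless. -/
theorem goodSample_of_lt {n : ℕ} (hn : 3 ≤ n) (G : Multigraph n) {p b c D K M A L : ℝ}
    (h0 : 0 < p) (h1 : p < 1) (hc : 0 < c) (hD : 1 ≤ D) (hK : 1 ≤ K) (hA : 4 * D ≤ A)
    (hAb : 32 * (|b| + 4) / c ≤ A) (hL : Real.log n ≤ L)
    (hM : 8 * (D + 3) * Real.log n * (A * L * L * L) ≤ M)
    (hlow : c ≤ G.minCut * -Real.log p)
    (hhigh : G.minCut * -Real.log p ≤ 4 * (D + 3) * Real.log n)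
    (hu : (n : ℝ) ^ (-D) ≤ G.unreliability p) (hcase : 1 - 1 / (A * L * L * L) < p) :
    GoodSample G p b K M ((1 - p) / (1 - (1 - 1 / (A * L * L * L))))
      (1 - 1 / (A * L * L * L)) ((1 - p) / (1 - (1 - 1 / (A * L * L * L)))) := by
  have hlog := one_lt_log hn
  have hn0 : (0 : ℝ) < n := by positivity
  have hL1 : 1 < L := hlog.trans_le hL
  have hA4 : 4 ≤ A := by linarith
  set R := A * L * L * L with hR
  have hLL : 1 < L * L := by nlinarith
  have hLLL : Real.log n ^ 3 ≤ L * L * L := by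
    calc Real.log n ^ 3 ≤ L ^ 3 := pow_le_pow_left₀ (by linarith) hL 3
      _ = L * L * L := by ring
  have hRlog : A * Real.log n ^ 3 ≤ R := by
    rw [hR]; nlinarith
  have hlog3 : Real.log n ≤ Real.log n ^ 3 := le_self_pow₀ hlog.le (by norm_num)
  have hR4 : 4 ≤ R := by nlinarith
  have hα : (1 - p) / (1 - (1 - 1 / R)) = (1 - p) * R := by
    rw [sub_sub_cancel, div_div_eq_mul_div, div_one]
  rw [hα]
  have hR' : R * (1 / R) = 1 := mul_one_div_cancel (by positivity)
  have hRinv : 1 / R ≤ 1 / 4 := one_div_le_one_div_of_le (by norm_num) hR4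
  have hRpos : 0 < 1 / R := by positivity
  have hα0 : 0 < (1 - p) * R := mul_pos (by linarith) (by linarith)
  have hα1 : (1 - p) * R ≤ 1 := by
    have : (1 - p) * R ≤ 1 / R * R := by gcongr; linarith
    linarith
  have hmean : 1 - (1 - p) * R * (1 - (1 - 1 / R)) = p := by
    rw [sub_sub_cancel, mul_assoc, hR']; ring
  have hu0 : 0 < G.unreliability p := lt_of_lt_of_le (by positivity) hu
  have hc1 : 1 ≤ G.minCut := by
    rcases Nat.eq_zero_or_pos G.minCut with h | h
    · rw [h] at hlow; simp at hlow; linarith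
    · exact h
  have hlp1 : 1 - p ≤ -Real.log p := by linarith [Real.log_le_sub_one_of_pos h0]
  have hlp2 : -Real.log p ≤ 2 * (1 - p) := by
    have h2 := Real.log_le_sub_one_of_pos (inv_pos.2 h0)
    rw [Real.log_inv] at h2
    have h3 : p⁻¹ - 1 ≤ 2 * (1 - p) := by
      rw [sub_le_iff_le_add, inv_le_iff_one_le_mul₀ h0]
      nlinarith
    linarith
  have hcut : (0 : ℝ) ≤ G.minCut := Nat.cast_nonneg _
  have hlow2 : c / 2 ≤ G.minCut * (1 - p) := by nlinarith
  have hhigh2 : G.minCut * (1 - p) ≤ 4 * (D + 3) * Real.log n := by nlinarith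
  refine ⟨hα0, hα1, hα0.le, hα1, ?_, by linarith, hcase, hmean, ?_⟩
  · have hδ0 : 0 < 1 / Real.log n := by positivity
    have hδ1 : 1 / Real.log n ≤ 1 := by rw [div_le_one (by linarith)]; exact hlog.le
    have hAc : 32 * (|b| + 4) ≤ A * c := by rwa [div_le_iff₀ hc] at hAb
    have hkey := G.keepAvg_not_preservesCuts_le (by omega) (B := |b| + 2) hα0.le hα1 hδ0.le hδ1
      hc1 (by positivity) (by
        have h2 := log_two_mul_le (n := n) (by omega)
        have h3 : c / 2 * (A * Real.log n ^ 3) ≤ G.minCut * (1 - p) * R :=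
          mul_le_mul hlow2 hRlog (by positivity) (by linarith)
        have h4 : G.minCut * ((1 - p) * R * (1 / Real.log n) ^ 2 / 4) =
            (G.minCut * (1 - p) * R) * ((1 / Real.log n) ^ 2 / 4) := by ring
        have h5 : c / 2 * (A * Real.log n ^ 3) * ((1 / Real.log n) ^ 2 / 4) =
            A * c * Real.log n / 8 := by field_simp; ring
        have h6 := mul_le_mul_of_nonneg_right h3
          (show 0 ≤ (1 / Real.log n) ^ 2 / 4 by positivity)
        rw [h4]
        rw [h5] at h6
        refine le_trans ?_ h6
        calc 2 * (|b| + 2 + 2) * Real.log (2 * n) ≤ 2 * (|b| + 2 + 2) * (2 * Real.log n) := by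
              gcongr
          _ = 32 * (|b| + 4) * Real.log n / 8 := by ring
          _ ≤ A * c * Real.log n / 8 := by gcongr)
    classical
    refine le_trans ?_ (G.prob_sampleLaw_ge hα0.le hα1
      (Good := fun H => H.PreservesCuts G ((1 - p) * R) (1 / Real.log n)) _
      (fun H hH => ⟨?_, ?_⟩) (by convert hkey))
    · linarith [four_mul_rpow_neg_le (n := n) (by omega) b]
    · refine le_trans (Multigraph.PreservesCuts.minCut_le (by omega) hH) (le_trans ?_ hM)
      calc (1 + 1 / Real.log n) * ((1 - p) * R) * G.minCut
          ≤ 2 * ((1 - p) * R) * G.minCut := by gcongr; linarith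
        _ = 2 * (G.minCut * (1 - p)) * R := by ring
        _ ≤ 2 * (4 * (D + 3) * Real.log n) * R := by gcongr
        _ = 8 * (D + 3) * Real.log n * R := by ring
    · exact hH.mono hα0.le (div_le_div_of_nonneg_right hK (by linarith))
  · have hq0 : 0 ≤ 1 - 1 / R := by linarith
    have h2 := G.relSecondMoment_le hα0.le hα1 hq0 (by linarith) (by rw [hmean]; exact hu0)
    rw [hmean] at h2
    refine h2.trans (rpow_neg_le_two hn (by linarith) hu (by linarith) ?_)
    calc 4 * D * Real.log n ≤ A * Real.log n := by gcongr
      _ ≤ A * Real.log n ^ 3 := by gcongr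
      _ ≤ R := hRlog

/-- The case in which the minimum cut is small already, and with high probability no edge is
deleted. The cuts are preserved with the factor `1` in place of `α`. -/
theorem goodSample_of_le {n : ℕ} (hn : 3 ≤ n) (G : Multigraph n) {p b D K M R E : ℝ}
    (h0 : 0 < p) (h1 : p < 1) (hD : 1 ≤ D) (hK : 0 ≤ K) (hm : 1 ≤ G.m) (hR : 0 < R)
    (hE4 : 4 * (n : ℝ) ^ (2 * D) ≤ E) (hEb : (n : ℝ) ^ b ≤ E)
    (hM : 4 * (D + 3) * Real.log n * R ≤ M)
    (hhigh : G.minCut * -Real.log p ≤ 4 * (D + 3) * Real.log n)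
    (hu : (n : ℝ) ^ (-D) ≤ G.unreliability p) (hcase : ¬ 1 - 1 / R < p) :
    GoodSample G p b K M 1 ((p - p / (G.m * E)) / (1 - p / (G.m * E)))
      ((1 - p) / (1 - (p - p / (G.m * E)) / (1 - p / (G.m * E)))) := by
  have hlog := one_lt_log hn
  have hn0 : (0 : ℝ) < n := by positivity
  have hn1 : (1 : ℝ) ≤ n := by exact_mod_cast (by omega : 1 ≤ n)
  have hm1 : (1 : ℝ) ≤ G.m := by exact_mod_cast hm
  have hnD : 1 ≤ (n : ℝ) ^ (2 * D) := Real.one_le_rpow hn1 (by linarith)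
  have hE : 4 ≤ E := by linarith
  have hmE : 4 ≤ G.m * E := by nlinarith
  set η := p / (G.m * E) with hη
  have hη0 : 0 < η := by positivity
  have hηp : η ≤ p / 4 := by rw [hη]; gcongr
  have hq : 1 - (p - η) / (1 - η) = (1 - p) / (1 - η) := by
    have : 1 - η ≠ 0 := by linarith
    field_simp; ring
  have hα : (1 - p) / (1 - (p - η) / (1 - η)) = 1 - η := by
    rw [hq, div_div_cancel₀ (by linarith)]
  have hq0 : 0 < (p - η) / (1 - η) := div_pos (by linarith) (by linarith)
  have hqp : (p - η) / (1 - η) < p := by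
    rw [div_lt_iff₀ (by linarith)]; nlinarith
  have hmean : 1 - (1 - η) * (1 - (p - η) / (1 - η)) = p := by
    rw [hq, mul_div_cancel₀ _ (by linarith)]; ring
  rw [hα]
  have hα0 : 0 ≤ 1 - η := by linarith
  have hα1 : 1 - η ≤ 1 := by linarith
  have hpow : 1 - 1 / E ≤ (1 - η) ^ G.m := by
    have h2 := one_add_mul_le_pow (a := -η) (by linarith) G.m
    have h3 : (G.m : ℝ) * η ≤ 1 / E := by
      rw [hη]
      calc (G.m : ℝ) * (p / (G.m * E)) = p / E := by field_simp
        _ ≤ 1 / E := by gcongr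
    rw [← sub_eq_add_neg] at h2
    linarith
  have hu0 : 0 < G.unreliability p := lt_of_lt_of_le (by positivity) hu
  refine ⟨one_pos, le_rfl, hα0, hα1, ?_, hq0, hqp, hmean, ?_⟩
  · have hgood : keepAvg (1 - η) G.edgeList (fun l' =>
        if (Multigraph.ofList l').edgeList = G.edgeList then 0 else 1) ≤
        1 / E := by
      have h2 := pow_length_mul_le_keepAvg hα0 hα1 G.edgeList
        (X := fun l' => 1 + -1 * if (Multigraph.ofList l').edgeList = G.edgeList then 0 else 1)
        fun l' => by split_ifs <;> norm_num
      rw [keepAvg_add, keepAvg_const, keepAvg_const_mul, G.length_edgeList] at h2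
      simp only [Multigraph.edgeList_ofList, if_true] at h2 ⊢
      linarith
    refine le_trans ?_ (G.prob_sampleLaw_ge hα0 hα1
      (Good := fun H => H.edgeList = G.edgeList) _ (fun H hH => ?_) hgood)
    · have : 1 / E ≤ (n : ℝ) ^ (-b) := by
        rw [Real.rpow_neg hn0.le, ← one_div]
        exact one_div_le_one_div_of_le (by positivity) hEb
      linarith
    · have hcard : ∀ S, (H.boundary S).card = (G.boundary S).card := fun S => by
        rw [Multigraph.card_boundary, Multigraph.card_boundary, hH]
      have hpres : ∀ {δ : ℝ}, 0 ≤ δ → H.PreservesCuts G 1 δ := by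
        intro δ hδ S
        rw [hcard]
        have : (0 : ℝ) ≤ (G.boundary S).card := Nat.cast_nonneg _
        constructor <;> nlinarith
      refine ⟨?_, hpres (div_nonneg hK (by linarith))⟩
      refine ((hpres le_rfl).minCut_le (by omega)).trans (le_trans ?_ hM)
      have hlp1 : 1 - p ≤ -Real.log p := by linarith [Real.log_le_sub_one_of_pos h0]
      have hR1 : 1 ≤ (1 - p) * R := by
        rw [not_lt] at hcase
        rw [← div_le_iff₀ hR]; linarith
      have hcut : (0 : ℝ) ≤ G.minCut := Nat.cast_nonneg _
      calc (1 + 0) * 1 * (G.minCut : ℝ) = G.minCut * 1 := by ring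
        _ ≤ G.minCut * ((1 - p) * R) := by gcongr
        _ = G.minCut * (1 - p) * R := by ring
        _ ≤ G.minCut * -Real.log p * R := by gcongr
        _ ≤ 4 * (D + 3) * Real.log n * R := by gcongr
  · refine G.relSecondMoment_le_two hα0 hα1 hq0.le (by linarith) ?_ ?_ ?_
    · rw [hmean]; exact hu0
    · rw [hmean]; exact G.unreliability_le_one h0.le h1.le
    · rw [hmean]
      refine le_trans ?_ hpow
      have h2 : (n : ℝ) ^ (-(2 * D)) ≤ G.unreliability p ^ 2 := by
        calc (n : ℝ) ^ (-(2 * D)) = ((n : ℝ) ^ (-D)) ^ 2 := by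
              rw [← Real.rpow_natCast, ← Real.rpow_mul hn0.le]
              congr 1; push_cast; ring
          _ ≤ _ := by gcongr
      have h3 : 1 / E ≤ (n : ℝ) ^ (-(2 * D)) / 4 := by
        rw [Real.rpow_neg hn0.le, div_le_div_iff₀ (by linarith) (by norm_num),
          ← div_eq_inv_mul, le_div_iff₀ (by positivity)]
        linarith
      linarith

end

end Unreliability

theorem mainTheorem12 (C c b : ℝ) (hc : 0 < c) :
    ∃ (P : Unreliability.Program) (κ k : ℕ) (K : ℝ),
      ∀ (n : ℕ) (G : Unreliability.Multigraph n) (p : ℝ),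
        3 ≤ n → 0 < p → p < 1 → G.RecursiveCase C c p →
        ∃ (T : ℕ) (μ : PMF (Unreliability.Multigraph n)) (q α : ℝ),
          -- the algorithm and its running time
          Unreliability.Computes P κ T G p μ q ∧
          (T : ℝ) ≤ K * G.m * Real.log n ^ k ∧
          -- the random graph is a sparsifier of `G`, with a small minimum cut
          (∀ H ∈ μ.support, H.IsSubgraph G) ∧
          0 < α ∧ α ≤ 1 ∧
          1 - (n : ℝ) ^ (-b) ≤ Unreliability.prob μ
            {H | (H.minCut : ℝ) ≤ K * Real.log n ^ k ∧ H.PreservesCuts G α (K / Real.log n)} ∧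
          -- the new failure probability
          0 < q ∧ q < p ∧
          -- the estimator is unbiased and has a small relative second moment
          Unreliability.expect μ (fun H => H.unreliability q) = G.unreliability p ∧
          Unreliability.relSecondMoment μ (fun H => H.unreliability q) ≤
            2 + K / Real.log n := by
  open Unreliability in
  set D := 1 + |C| / Real.log (Real.log 3) with hD
  have hD1 : 1 ≤ D := by
    have h3 : 1 < Real.log 3 := by exact_mod_cast one_lt_log (n := 3) le_rfl
    have : 0 < Real.log (Real.log 3) := Real.log_pos h3
    have : 0 ≤ |C| / Real.log (Real.log 3) := by positivity
    linarith
  -- `A` makes `1 - q` small against `D`, and `α λ` large against `b`; the size of `2 ^ N` matters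
  -- only where `q` is close to `p`, as `(2 ^ N) ^ L ≥ n ^ N` bounds the chance of a deletion
  obtain ⟨A, hA⟩ := exists_nat_ge (max (4 * D) (32 * (|b| + 4) / c))
  obtain ⟨N, hN⟩ := exists_nat_ge (max (2 * D + 2) |b|)
  rw [max_le_iff] at hA hN
  set K : ℝ := 50 + 216 * A * (D + 3) with hK
  have hA0 : (0 : ℝ) ≤ A := Nat.cast_nonneg A
  have hK50 : 50 ≤ K := by
    have : 0 ≤ 216 * A * (D + 3) := by positivity
    linarith
  refine ⟨sparsify A (2 ^ N), A + N + 2, 4, K, fun n G p hn h0 h1 hrec => ?_⟩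
  have hlog := one_lt_log hn
  have hn0 : (0 : ℝ) < n := by positivity
  have hn1 : (1 : ℝ) ≤ n := by exact_mod_cast (by omega : 1 ≤ n)
  have hu := rpow_neg_le_of_recursiveCase G hn hrec
  rw [← hD] at hu
  have hlow := G.le_minCut_mul_neg_log hn hc h0 hrec.2
  have hhigh := G.minCut_mul_neg_log_le hn h0 h1 (by linarith) hu
  have hm : 1 ≤ G.m := by
    obtain ⟨S, -, hS⟩ := G.exists_card_boundary_eq_minCut (by omega)
    by_contra hcon
    have h2 : (G.boundary S).card ≤ G.m := by
      simpa using Finset.card_le_univ (G.boundary S)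
    rw [show G.minCut = 0 by omega] at hlow
    simp at hlow
    linarith
  have hm1 : (1 : ℝ) ≤ G.m := by exact_mod_cast hm
  set L := Nat.clog 2 n with hL
  have hL1 := log_le_clog hn
  have hL2 := clog_le_three_mul_log hn
  rw [← hL] at hL1 hL2
  have hL0 : (0 : ℝ) ≤ L := Nat.cast_nonneg L
  have hlog4 : Real.log n ≤ Real.log n ^ 4 := le_self_pow₀ hlog.le (by norm_num)
  have hM : 8 * (D + 3) * Real.log n * ((A : ℝ) * L * L * L) ≤ K * Real.log n ^ 4 := by
    have h2 : (L : ℝ) ^ 3 ≤ 27 * Real.log n ^ 3 := by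
      calc (L : ℝ) ^ 3 ≤ (3 * Real.log n) ^ 3 := pow_le_pow_left₀ hL0 hL2 3
        _ = 27 * Real.log n ^ 3 := by ring
    calc 8 * (D + 3) * Real.log n * ((A : ℝ) * L * L * L)
        = 8 * A * (D + 3) * Real.log n * (L : ℝ) ^ 3 := by ring
      _ ≤ 8 * A * (D + 3) * Real.log n * (27 * Real.log n ^ 3) := by gcongr
      _ = 216 * A * (D + 3) * Real.log n ^ 4 := by ring
      _ ≤ K * Real.log n ^ 4 := by gcongr; linarith
  have hgood : ∃ β, GoodSample G p b K (K * Real.log n ^ 4) β (newProb A (2 ^ N) L G.m p)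
      ((1 - p) / (1 - newProb A (2 ^ N) L G.m p)) := by
    by_cases hcase : 1 - 1 / ((A : ℝ) * L * L * L) < p
    · rw [newProb, if_pos hcase]
      exact ⟨_, goodSample_of_lt hn G h0 h1 hc hD1 (by linarith) hA.1 hA.2 hL1 hM hlow hhigh hu
        hcase⟩
    · rw [newProb, if_neg hcase]
      have hE : (n : ℝ) ^ (N : ℝ) ≤ ((2 ^ N : ℕ) : ℝ) ^ L := by
        have h2 : n ^ N ≤ (2 ^ N) ^ L := by
          rw [← pow_mul, mul_comm, pow_mul]
          exact Nat.pow_le_pow_left (Nat.le_pow_clog (by norm_num) n) N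
        rw [Real.rpow_natCast]
        exact_mod_cast h2
      have hR : 0 < (A : ℝ) * L * L * L := by
        have h2 : (0 : ℝ) < A := by linarith
        have h3 : (0 : ℝ) < L := by linarith
        positivity
      refine ⟨1, goodSample_of_le hn G h0 h1 hD1 (by linarith) hm hR (le_trans ?_ hE)
        (le_trans ?_ hE) (le_trans ?_ hM) hhigh hu hcase⟩
      · calc 4 * (n : ℝ) ^ (2 * D) ≤ (n : ℝ) ^ (2 : ℝ) * (n : ℝ) ^ (2 * D) := by
              gcongr
              rw [Real.rpow_two]
              have : (3 : ℝ) ≤ n := by exact_mod_cast hn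
              nlinarith
          _ = (n : ℝ) ^ (2 + 2 * D) := (Real.rpow_add hn0 _ _).symm
          _ ≤ (n : ℝ) ^ (N : ℝ) :=
              Real.rpow_le_rpow_of_exponent_le hn1 (by linarith)
      · exact Real.rpow_le_rpow_of_exponent_le hn1 ((le_abs_self b).trans hN.2)
      · gcongr; norm_num
  obtain ⟨β, hg⟩ := hgood
  have hbig : ∀ j ≤ A + N + 2, 2 ^ j ≤ 2 ^ (A + N + 2) := fun j hj =>
    Nat.pow_le_pow_right (by norm_num) hj
  obtain ⟨T, hT, hcomp⟩ := computes_sparsify A (2 ^ N) (A + N + 2) (by omega)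
    ((Nat.lt_two_pow_self).trans_le (hbig A (by omega)))
    ((Nat.pow_lt_pow_right (by norm_num) (by omega))) (by omega) G hm p
  refine ⟨T, _, _, β, hcomp, ?_, fun H hH => Multigraph.isSubgraph_of_mem_support_sampleLaw hH,
    hg.hβ0, hg.hβ1, hg.hprob, hg.hq0, hg.hqp, ?_, ?_⟩
  · have hT' : (T : ℝ) ≤ 4 * L + 11 * G.m + 27 := by exact_mod_cast hT
    have h2 : 1 ≤ Real.log n ^ 4 := one_le_pow₀ hlog.le
    calc (T : ℝ) ≤ 12 * Real.log n + 11 * G.m + 27 := by linarith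
      _ ≤ 12 * (G.m * Real.log n ^ 4) + 11 * (G.m * Real.log n ^ 4) +
          27 * (G.m * Real.log n ^ 4) := by gcongr <;> nlinarith
      _ = 50 * G.m * Real.log n ^ 4 := by ring
      _ ≤ K * G.m * Real.log n ^ 4 := by gcongr
  · exact (G.expect_unreliability hg.hα0 hg.hα1).trans (by rw [hg.hmean])
  · have : 0 ≤ K / Real.log n := by positivity
    exact hg.hmoment.trans (by linarith)
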